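/- **Setting.** Let $F$ be a closed connected oriented smooth surface with base point $x$, and $I=[0,1]$. Identify $SU(2)$ with the unit quaternions; for a purely imaginary unit quaternion $Q$ put $e^{\alpha Q}=\cos\alpha+\sin\alpha\,Q$. Products in $\pi_1$ are read from left to right, and $\mathcal M(F)=\operatorname{Hom}(\pi_1(F,x),SU(2))/\mathrm{conj}$. Let $\phi:\mathbb R\to\mathbb R$ be a $C^k$, odd, $2\pi$-periodic function. Let $C\subset F$ be a smoothly embedded oriented circle missing $x$. Give $F\times I$ the product orientation, and let $N_C:S^1\times D^2\to F\times(0,1)$ be the product tubular neighborhood $N_C(s,z)=\big(c(s,-\operatorname{Im}z),\ \tfrac12+r\operatorname{Re}z\big)$ of $C\times\{\tfrac12\}$, where $0<r<\tfrac12$ and $c:S^1\times\mathbb R\to F$ is an orientation preserving smooth embedding with $c(\cdot,0)$ parametrizing $C$ and $x\notin c(S^1\times[-1,1])$. Thus $N_C$ preserves orientation, misses $\{x\}\times I$, and is framed so that $\lambda=N_C(S^1\times\{1\})$ is the push-off $C\times\{\tfrac12+r\}$. Put $\mu=N_C(\{1\}\times\partial D^2)$ and $\pi_C=(N_C,\phi)$.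 A $\pi_C$-perturbed representation is a homomorphism $\tilde\rho:\pi_1\big((F\times I)\setminus N_C(S^1\times\operatorname{int}D^2),(x,0)\big)\to SU(2)$ such that $\tilde\rho(\mu)=e^{\phi(\alpha)Q}$ when $\tilde\rho(\lambda)=e^{\alpha Q}$ (here $\mu,\lambda$ are connected to the base point by a common path). Let $\mathcal M_{\pi_C}(F\times I)$ be the set of conjugacy classes of these, and let $$\Phi_{\pi_C}:\ \mathcal M(F)=\mathcal M(F\times\{0\})\leftarrow\mathcal M_{\pi_C}(F\times I)\to\mathcal M(F\times\{1\})=\mathcal M(F)$$ be the composite of the inverse of restriction to $F\times\{0\}$ with restriction to $F\times\{1\}$. (Curves meet in a single point if they do so for exactly one parameter of $E$, respectively $\gamma_E$.) For a path $\gamma_E$ from $x$ to a point $p$ and a loop $E$ based at $p$, write $\rho(E)$ for $\rho([\gamma_E*E*\gamma_E^{-1}])$. If $C$ meets $E$ in a single point $y$ and misses $\gamma_E$, the longitude $\lambda_C(E)$ runs along $\gamma_E$, forward along $E$ to $y$, once around $C$, and the same way back. If $C$ misses $E$ and meets $\gamma_E$ in a single point $y$, it runs along $\gamma_E$ to $y$,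 once around $C$, and back along $\gamma_E$. **Proposition.** For every homomorphism $\rho:\pi_1(F,x)\to SU(2)$ there is a $\pi_C$-perturbed representation $\tilde\rho$ that restricts to $\rho$ on $F\times\{0\}$ and whose restriction $\rho'$ to $F\times\{1\}$ (connected to the base point along $\{x\}\times I$) represents $\Phi_{\pi_C}([\rho])$, such that, writing $\Phi_{\pi_C}(\rho)$ for $\rho'$, the following hold for all $E$ and $\gamma_E$. 1. If $C$ is disjoint from $E\cup\gamma_E$, then $\Phi_{\pi_C}(\rho)(E)=\rho(E)$. 2. If $C$ meets $E$ transversely in a single point with $E\cdot C=\varepsilon\in\{1,-1\}$ and misses $\gamma_E$, and if $\rho(\lambda_C(E))=e^{\alpha Q}$, then $\Phi_{\pi_C}(\rho)(E)=e^{\varepsilon\phi(\alpha)Q}\rho(E)$. 3. If $C$ misses $E$ and meets $\gamma_E$, oriented away from the base point, transversely in a single point with $\gamma_E\cdot C=\varepsilon\in\{1,-1\}$, and if $\rho(\lambda_C(E))=e^{\alpha Q}$, then $\Phi_{\pi_C}(\rho)(E)=e^{\varepsilon\phi(\alpha)Q}\rho(E)e^{-\varepsilon\phi(\alpha)Q}$.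 -/

import Mathlib

open scoped Manifold ContDiff Quaternion

noncomputable section

namespace CylinderPert

/-! ### Unit quaternions and perturbation functions -/

/-- `SU(2)`, identified with the group of unit quaternions. -/
abbrev SU2 : Type := unitary ℍ[ℝ]

/-- Purely imaginary quaternions of length one: unit vectors in the Lie algebra `su(2)`. -/
def IsUnitImag (Q : ℍ[ℝ]) : Prop := Q.re = 0 ∧ ‖Q‖ = 1

theorem exp_smul_unitImag {Q : ℍ[ℝ]} (hQ : IsUnitImag Q) (α : ℝ) :
    NormedSpace.exp (α • Q) = ((Real.cos α : ℝ) : ℍ[ℝ]) + Real.sin α • Q := by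
  rw [Quaternion.exp_of_re_eq_zero _ (by simp [hQ.1])]
  simp only [norm_smul, hQ.2, Real.norm_eq_abs, mul_one, Real.cos_abs]
  rcases eq_or_ne α 0 with rfl | h
  · simp
  · congr 1
    rw [smul_smul]
    congr 1
    rcases abs_cases α with ⟨h1, _⟩ | ⟨h1, _⟩ <;> rw [h1]
    · field_simp
    · rw [Real.sin_neg]; field_simp

theorem exp_mem_unitary {Q : ℍ[ℝ]} (hQ : Q.re = 0) :
    NormedSpace.exp Q ∈ unitary ℍ[ℝ] := by
  have h : ‖NormedSpace.exp Q‖ = 1 := by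
    rw [Quaternion.norm_exp, hQ]; simp
  have h2 : Quaternion.normSq (NormedSpace.exp Q) = 1 := by
    rw [Quaternion.normSq_eq_norm_mul_self, h]; norm_num
  rw [Unitary.mem_iff, Quaternion.star_mul_self, Quaternion.self_mul_star, h2]
  simp

/-- The perturbation functions: odd, `2π`-periodic functions `ℝ → ℝ` of class `C^k`. -/
structure PertFun (k : ℕ) where
  toFun : ℝ → ℝ
  contDiff : ContDiff ℝ k toFun
  odd : ∀ t, toFun (-t) = -toFun t
  periodic : ∀ t, toFun (t + 2 * Real.pi) = toFun t

instance (k : ℕ) : CoeFun (PertFun k) (fun _ => ℝ → ℝ) := ⟨PertFun.toFun⟩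

/-- The conjugation equivariant map `SU(2) → SU(2)`, `e^{αQ} ↦ e^{f(α)Q}`, written out for the
angle `α = arccos (Re g)` and the axis `Q = Im g / |Im g|`; see `pertMap_of_eq_exp`. -/
def pertMap {k : ℕ} (f : PertFun k) (g : SU2) : SU2 :=
  ⟨NormedSpace.exp (f (Real.arccos (g : ℍ[ℝ]).re) • (‖(g : ℍ[ℝ]).im‖⁻¹ • (g : ℍ[ℝ]).im)),
    exp_mem_unitary (by simp)⟩

/-- The defining property of `pertMap`, for every way of writing `g` as `e^{αQ}`. -/
theorem pertMap_of_eq_exp {k : ℕ} (f : PertFun k) (g : SU2) {α : ℝ} {Q : ℍ[ℝ]}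
    (hQ : IsUnitImag Q) (hg : (g : ℍ[ℝ]) = NormedSpace.exp (α • Q)) :
    (pertMap f g : ℍ[ℝ]) = NormedSpace.exp (f α • Q) := by
  have hper : ∀ (n : ℤ) t, f (t + n * (2 * Real.pi)) = f t := by
    intro n t
    have : Function.Periodic f.toFun (2 * Real.pi) := f.periodic
    exact this.int_mul n t
  rw [exp_smul_unitImag hQ] at hg
  have hQim : Q.im = Q := by ext <;> simp [hQ.1]
  have hre : (g : ℍ[ℝ]).re = Real.cos α := by rw [hg]; simp [hQ.1]
  have him : (g : ℍ[ℝ]).im = Real.sin α • Q := by rw [hg]; simp [hQim]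
  have hn : ‖(g : ℍ[ℝ]).im‖ = |Real.sin α| := by rw [him, norm_smul, hQ.2]; simp
  simp only [pertMap]
  congr 1
  rw [hn, hre, him, smul_smul, smul_smul]
  congr 1
  have hβ : 0 ≤ Real.sin (Real.arccos (Real.cos α)) :=
    Real.sin_nonneg_of_nonneg_of_le_pi (Real.arccos_nonneg _) (Real.arccos_le_pi _)
  have hc : Real.cos (Real.arccos (Real.cos α)) = Real.cos α :=
    Real.cos_arccos (Real.neg_one_le_cos α) (Real.cos_le_one α)
  generalize Real.arccos (Real.cos α) = β at hβ hc
  by_cases hs : Real.sin α = 0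
  · obtain ⟨n, hn⟩ := Real.sin_eq_zero_iff.1 hs
    have h1 : f α = f (-α) := by
      rw [← hper n (-α)]; congr 1; rw [← hn]; ring
    rw [f.odd] at h1
    rw [hs, show f α = 0 by linarith]; simp
  · obtain ⟨n, hn | hn⟩ := Real.cos_eq_cos_iff.1 hc
    · have hα : α = β + n * (2 * Real.pi) := by rw [hn]; ring
      have h2 : Real.sin α = Real.sin β := by rw [hα, Real.sin_add_int_mul_two_pi]
      rw [hα, hper, ← hα, h2, abs_of_nonneg hβ, mul_assoc, inv_mul_cancel₀ (h2 ▸ hs), mul_one]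
    · have hα : α = -β + n * (2 * Real.pi) := by rw [hn]; ring
      have h2 : Real.sin α = -Real.sin β := by rw [hα, Real.sin_add_int_mul_two_pi, Real.sin_neg]
      have h3 : Real.sin β ≠ 0 := by intro h; exact hs (by rw [h2, h, neg_zero])
      rw [hα, hper, ← hα, h2, abs_neg, abs_of_nonneg hβ, f.odd, mul_neg, mul_assoc,
        inv_mul_cancel₀ h3, mul_one]

/-! ### Fundamental groups, representations, character varieties -/

/-- The fundamental group with the usual product: `[p] * [q]` is first `p`, then `q`. (The product
of Mathlib's `FundamentalGroup` composes in the opposite order.) -/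
abbrev Pi1 (X : Type*) [TopologicalSpace X] (x : X) : Type _ := (FundamentalGroup X x)ᵐᵒᵖ

section
variable {X : Type*} [TopologicalSpace X] {x y : X}

/-- The element of the fundamental group represented by a based loop. -/
def loopClass (p : Path x x) : Pi1 X x :=
  MulOpposite.op (FundamentalGroup.fromPath (Path.Homotopic.Quotient.mk p))

theorem loopClass_trans (p q : Path x x) :
    loopClass (p.trans q) = loopClass p * loopClass q := rfl

/-- The based loop `δ * l * δ⁻¹`. -/
def connect (δ : Path x y) (l : Path y y) : Path x x := (δ.trans l).trans δ.symm

end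

/-- Homomorphisms from the fundamental group to `SU(2)`. -/
abbrev Rep (X : Type*) [TopologicalSpace X] (x : X) : Type _ := Pi1 X x →* SU2

/-- Conjugacy of homomorphisms to `SU(2)`. -/
def repSetoid (X : Type*) [TopologicalSpace X] (x : X) : Setoid (Rep X x) where
  r ρ σ := ∃ g : SU2, ∀ a, σ a = g * ρ a * g⁻¹
  iseqv :=
    { refl := fun ρ => ⟨1, by simp⟩
      symm := by
        rintro ρ σ ⟨g, hg⟩
        exact ⟨g⁻¹, fun a => by rw [hg]; group⟩
      trans := by
        rintro ρ σ τ ⟨g, hg⟩ ⟨h, hh⟩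
        exact ⟨h * g, fun a => by rw [hh, hg]; group⟩ }

/-- The `SU(2)` character variety (as a set): conjugacy classes of homomorphisms
`π₁(X, x) → SU(2)`. -/
def CharVar (X : Type*) [TopologicalSpace X] (x : X) : Type _ := Quotient (repSetoid X x)

/-- The conjugacy class of a homomorphism. -/
def CharVar.mk {X : Type*} [TopologicalSpace X] {x : X} (ρ : Rep X x) : CharVar X x :=
  Quotient.mk (repSetoid X x) ρ

/-- The homomorphism `π₁(Y, y) → π₁(X, x)` given by a continuous map `f : Y → X` and a path `δ`
from `x` to `f y`; it sends `[l]` to `[δ * f(l) * δ⁻¹]`. -/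
def pi1Map {X Y : Type*} [TopologicalSpace X] [TopologicalSpace Y] {x : X} (f : C(Y, X)) (y : Y)
    (δ : Path x (f y)) : Pi1 Y y →* Pi1 X x :=
  MonoidHom.op
    ((FundamentalGroup.fundamentalGroupMulEquivOfPath δ.symm).toMonoidHom.comp
      (FundamentalGroup.map f y))

theorem pi1Map_loopClass {X Y : Type*} [TopologicalSpace X] [TopologicalSpace Y] {x : X}
    (f : C(Y, X)) (y : Y) (δ : Path x (f y)) (l : Path y y) :
    pi1Map f y δ (loopClass l) = loopClass (connect δ (l.map f.continuous)) := by
  apply MulOpposite.unop_injective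
  change (FundamentalGroup.fundamentalGroupMulEquivOfPath δ.symm)
    (FundamentalGroup.fromPath (Path.Homotopic.Quotient.mk (l.map f.continuous))) =
      FundamentalGroup.fromPath (Path.Homotopic.Quotient.mk (connect δ (l.map f.continuous)))
  simp only [FundamentalGroup.fundamentalGroupMulEquivOfPath, CategoryTheory.Iso.conj_apply]
  rw [← CategoryTheory.Category.assoc]
  change Path.Homotopic.Quotient.mk ((δ.symm.symm.trans _).trans δ.symm) = _
  rw [Path.symm_symm]
  rfl

/-! ### Oriented surfaces and curves on them -/

/-- The standard area form of the plane. -/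
def cross (v w : EuclideanSpace ℝ (Fin 2)) : ℝ := v 0 * w 1 - v 1 * w 0

section
variable {F : Type*} [TopologicalSpace F] [ChartedSpace (EuclideanSpace ℝ (Fin 2)) F]

variable (F) in
/-- All coordinate changes between the charts of the atlas preserve the orientation. The surface is
then oriented by declaring all its charts orientation preserving. -/
def IsOrientedAtlas : Prop :=
  ∀ e ∈ atlas (EuclideanSpace ℝ (Fin 2)) F, ∀ e' ∈ atlas (EuclideanSpace ℝ (Fin 2)) F,
    ∀ v ∈ (e.symm.trans e').source, 0 < (fderiv ℝ (e.symm.trans e') v).det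

/-- The sign of the pair of velocity vectors `(u'(t), v'(s))` of two curves through the same point
`q = u(t) = v(s)`, in an oriented chart at `q`: it is `1` for a positive basis of the tangent plane,
`-1` for a negative basis, and `0` if the vectors are linearly dependent. -/
def crossSign (u v : ℝ → F) (t s : ℝ) : SignType :=
  SignType.sign
    (cross (deriv (fun τ => chartAt (EuclideanSpace ℝ (Fin 2)) (u t) (u τ)) t)
      (deriv (fun σ => chartAt (EuclideanSpace ℝ (Fin 2)) (u t) (v σ)) s))

variable (F) in
/-- A smoothly embedded oriented circle in the surface, as a `1`-periodic parametrization. -/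
structure EmbeddedCircle where
  toFun : ℝ → F
  smooth : ContMDiff 𝓘(ℝ, ℝ) (𝓡 2) ∞ toFun
  periodic : ∀ s, toFun (s + 1) = toFun s
  injective : ∀ s t, toFun s = toFun t → ∃ n : ℤ, t = s + n
  immersion : ∀ s, mfderiv 𝓘(ℝ, ℝ) (𝓡 2) toFun s ≠ 0

instance : CoeFun (EmbeddedCircle F) (fun _ => ℝ → F) := ⟨EmbeddedCircle.toFun⟩

/-- The point set of an embedded circle. -/
def EmbeddedCircle.carrier (C : EmbeddedCircle F) : Set F := Set.range C

/-- The loop that runs once around `C`, starting and ending at `C s`. -/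
def EmbeddedCircle.loop (C : EmbeddedCircle F) (s : ℝ) : Path (C s) (C s) where
  toFun t := C (s + t)
  continuous_toFun := C.smooth.continuous.comp (by fun_prop)
  source' := by simp
  target' := by simpa using C.periodic s

/-- `p` meets `C` transversely in exactly one point, for the parameter `t` of `p` and the parameter
`s` of `C`, with oriented intersection number `p · C = ε`. -/
structure MeetsOnce {a b : F} (p : Path a b) (C : EmbeddedCircle F) (t : unitInterval) (s : ℝ)
    (ε : ℤˣ) : Prop where
  meets : p t = C s
  unique : ∀ t' : unitInterval, p t' ∈ C.carrier → t' = t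
  sign : crossSign p.extend C t s = SignType.sign (ε : ℤ)

/-- The longitude of `C` with respect to a loop `E` connected to the base point by `γ`, for an
intersection point `E t = C s`: along `γ`, forward along `E` to the intersection point, once around
`C`, and the same way back. -/
def longitudeLoop {x p : F} (C : EmbeddedCircle F) (γ : Path x p) (E : Path p p) {t : unitInterval} {s : ℝ}
    (h : E t = C s) : Path x x :=
  connect (γ.trans ((E.subpath 0 t).cast E.source.symm h.symm)) (C.loop s)

/-- The longitude of `C` with respect to a loop which is connected to the base point by `γ`, for an
intersection point `γ t = C s`: along `γ` to the intersection point, once around `C`, and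
back along `γ`. -/
def longitudeArc {x p : F} (C : EmbeddedCircle F) (γ : Path x p) {t : unitInterval} {s : ℝ}
    (h : γ t = C s) : Path x x :=
  connect ((γ.subpath 0 t).cast γ.source.symm h.symm) (C.loop s)

/-! ### The perturbation solid torus in the cylinder -/

/-- A tubular neighborhood of `C × {1/2}` in the cylinder `F × [0, 1]` that misses the segment over
the base point `x`. It is the product of the annulus `|u| ≤ 1` in a tubular neighborhood
`collar : S¹ × ℝ → F` of `C` (an orientation preserving smooth embedding, `1`-periodic in the first
variable) with an interval of half-length `height`; see `PertTube.map` for its framing. -/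
structure PertTube (C : EmbeddedCircle F) (x : F) where
  collar : ℝ × ℝ → F
  smooth : ContMDiff 𝓘(ℝ, ℝ × ℝ) (𝓡 2) ∞ collar
  periodic : ∀ s u, collar (s + 1, u) = collar (s, u)
  injective : ∀ s u s' u', collar (s, u) = collar (s', u') → u' = u ∧ ∃ n : ℤ, s' = s + n
  oriented : ∀ s u, crossSign (fun s' => collar (s', u)) (fun u' => collar (s, u')) s u = 1
  core : ∀ s, collar (s, 0) = C s
  height : ℝ
  height_pos : 0 < height
  height_lt : height < 1 / 2
  base_notMem : ∀ s u, |u| ≤ 1 → collar (s, u) ≠ x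

namespace PertTube
variable {C : EmbeddedCircle F} {x : F} (N : PertTube C x)

/-- The embedding `N : S¹ × D² → F × (0, 1)`, with `D²` the closed unit disk in `ℂ` and `S¹ = ℝ / ℤ`.
The disk direction `1` points upwards, so that `N (S¹ × {1})` is a push-off `C × {1/2 + ε}`; the disk
direction `i` points to the right of `C`, so that `N` preserves the product orientations. -/
def map (s : ℝ) (z : ℂ) : F × ℝ := (N.collar (s, -z.im), 1 / 2 + N.height * z.re)

theorem continuous_map : Continuous fun p : ℝ × ℂ => N.map p.1 p.2 := by
  have := N.smooth.continuous
  unfold map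
  fun_prop

theorem map_injective {s s' : ℝ} {z z' : ℂ} (h : N.map s z = N.map s' z') : z' = z := by
  have h1 := congrArg Prod.fst h
  have h2 := congrArg Prod.snd h
  simp only [map] at h1 h2
  have h3 := (N.injective _ _ _ _ h1).1
  have := N.height_pos
  apply Complex.ext
  · have : N.height * (z'.re - z.re) = 0 := by linarith
    rcases mul_eq_zero.1 this with h | h <;> linarith
  · linarith

theorem map_snd_mem {s : ℝ} {z : ℂ} (hz : ‖z‖ < 1) :
    0 < (N.map s z).2 ∧ (N.map s z).2 < 1 := by
  have h := abs_lt.1 ((Complex.abs_re_le_norm z).trans_lt hz)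
  have h1 := N.height_pos
  have h2 := N.height_lt
  simp only [map]
  constructor <;> nlinarith [h.1, h.2]

/-- The cylinder `F × [0, 1]` with the open solid torus `N (S¹ × int D²)` removed. -/
def exterior : Set (F × ℝ) :=
  {q | q.2 ∈ Set.Icc (0 : ℝ) 1 ∧ ∀ (s : ℝ) (z : ℂ), ‖z‖ < 1 → N.map s z ≠ q}

theorem map_mem_exterior (s : ℝ) {z : ℂ} (hz : ‖z‖ = 1) : N.map s z ∈ N.exterior := by
  have h := abs_le.1 ((Complex.abs_re_le_norm z).trans_eq hz)
  have h1 := N.height_pos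
  have h2 := N.height_lt
  refine ⟨?_, fun s' z' hz' he => ?_⟩
  · simp only [map]
    constructor <;> nlinarith [h.1, h.2]
  · rw [← N.map_injective he, hz] at hz'
    exact lt_irrefl _ hz'

/-- The inclusion of the end `F = F × {0}`. -/
def inclBottom : C(F, N.exterior) where
  toFun y := ⟨(y, 0), by simp, fun s z hz he => by
    have := (N.map_snd_mem (s := s) hz).1
    rw [he] at this
    exact lt_irrefl _ this⟩
  continuous_toFun := by fun_prop

/-- The inclusion of the end `F = F × {1}`. -/
def inclTop : C(F, N.exterior) where
  toFun y := ⟨(y, 1), by simp, fun s z hz he => by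
    have := (N.map_snd_mem (s := s) hz).2
    rw [he] at this
    exact lt_irrefl _ this⟩
  continuous_toFun := by fun_prop

/-- The path `{x} × [0, 1]` over the base point. -/
def vertical : Path (N.inclBottom x) (N.inclTop x) where
  toFun t := ⟨(x, t), t.2, fun s z hz he => N.base_notMem s (-z.im)
    (by rw [abs_neg]; exact (Complex.abs_im_le_norm z).trans hz.le) (congrArg Prod.fst he)⟩
  continuous_toFun := by fun_prop
  source' := by ext <;> rfl
  target' := by ext <;> rfl

/-- The point `N (1, 1)` of the boundary torus. -/
def corner : N.exterior := ⟨N.map 0 1, N.map_mem_exterior 0 (by simp)⟩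

/-- The meridian `μ = N ({1} × ∂D²)`. -/
def meridian : Path N.corner N.corner where
  toFun t := ⟨N.map 0 (Complex.exp ((2 * Real.pi * (t : ℝ) : ℝ) * Complex.I)),
    N.map_mem_exterior 0 (Complex.norm_exp_ofReal_mul_I _)⟩
  continuous_toFun :=
    (N.continuous_map.comp (by fun_prop : Continuous fun t : unitInterval =>
      ((0 : ℝ), Complex.exp ((2 * Real.pi * (t : ℝ) : ℝ) * Complex.I)))).subtype_mk _
  source' := by simp [corner]
  target' := by simp [corner]

/-- The longitude `λ = N (S¹ × {1})`. -/
def longitude : Path N.corner N.corner where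
  toFun t := ⟨N.map t 1, N.map_mem_exterior t (by simp)⟩
  continuous_toFun :=
    (N.continuous_map.comp (by fun_prop : Continuous fun t : unitInterval =>
      ((t : ℝ), (1 : ℂ)))).subtype_mk _
  source' := by simp [corner]
  target' := by
    have := N.periodic 0 0
    rw [zero_add] at this
    simp [corner, map, this]

/-! ### Perturbed representations -/

/-- The perturbation condition `ρ(μ) = f(ρ(λ))`, where `f(e^{αQ}) = e^{φ(α)Q}`. Here `μ` and `λ` are
connected to the base point by a common path `δ`; the condition does not depend on `δ`. -/
def IsPerturbed {k : ℕ} (φ : PertFun k) (ρ : Rep N.exterior (N.inclBottom x)) : Prop :=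
  ∀ δ : Path (N.inclBottom x) N.corner,
    ρ (loopClass (connect δ N.meridian)) =
      pertMap φ (ρ (loopClass (connect δ N.longitude)))

/-- The perturbed representations of the cylinder, for the perturbation data `(N, φ)`. -/
def PertRep {k : ℕ} (φ : PertFun k) : Type _ :=
  {ρ : Rep N.exterior (N.inclBottom x) // N.IsPerturbed φ ρ}

variable {N} {k : ℕ} {φ : PertFun k}

/-- The restriction to `F × {0}`. -/
def PertRep.bottom (ρ : N.PertRep φ) : Rep F x :=
  ρ.1.comp (pi1Map N.inclBottom x (Path.refl _))

/-- The restriction to `F × {1}`, connected to the base point along `{x} × [0, 1]`. -/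
def PertRep.top (ρ : N.PertRep φ) : Rep F x :=
  ρ.1.comp (pi1Map N.inclTop x N.vertical)

variable (N φ)

/-- The perturbed character variety of the cylinder (as a set). -/
def PertCharVar : Type _ :=
  Quotient ((repSetoid N.exterior (N.inclBottom x)).comap
    (Subtype.val : N.PertRep φ → Rep N.exterior (N.inclBottom x)))

/-- The restriction map from the perturbed character variety to that of `F × {0}`. -/
def restrictBottom : N.PertCharVar φ → CharVar F x :=
  Quotient.lift (fun ρ => CharVar.mk (PertRep.bottom ρ))
    (fun _ _ ⟨g, hg⟩ => Quotient.sound ⟨g, fun _ => hg _⟩)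

/-- The restriction map from the perturbed character variety to that of `F × {1}`. -/
def restrictTop : N.PertCharVar φ → CharVar F x :=
  Quotient.lift (fun ρ => CharVar.mk (PertRep.top ρ))
    (fun _ _ ⟨g, hg⟩ => Quotient.sound ⟨g, fun _ => hg _⟩)

/-- The map `𝓜(F) = 𝓜(F × {0}) ← 𝓜_π(F × I) → 𝓜(F × {1}) = 𝓜(F)`: a class is extended to a perturbed
class of the cylinder, which is then restricted to the other end. (Both restriction maps are
bijective; where a class had no extension the formula below would return the class itself.) -/
def Phi : CharVar F x → CharVar F x :=
  Function.extend (N.restrictBottom φ) (N.restrictTop φ) id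

end PertTube

end

end CylinderPert

end

noncomputable section

namespace CylinderPert

/-! ### Parallel transport of flat bundles -/

open unitInterval

/-! A representation of `π₁(F, x)` is the holonomy of a flat parallel transport `R`, a functor on
the fundamental groupoid (`Transport.exists_of_hom`). Working with such functors removes base points
and connecting paths from the geometry. On any simply connected space mapped into the surface or the
exterior, the transport depends only on endpoints (`Transport.along`), so homotopies become
telescoping products.

Existence. Pull `R` back to the exterior, cut along the vertical annulus over `C` above the solid
torus, and reglue by `leftGauge`, which is `f` of the holonomy around `C` on the left and `1` on the
right, where `f` is `pertMap φ`. Since `f` commutes with conjugation, `f` of this holonomy is a flat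
section over the collar. Regluing is therefore consistent (`exists_twist`, by way of
`Transport.exists_glue`). The meridian crosses the cut once and acquires exactly `f` of the
longitude; the bottom and the segment over `x` do not see the cut (`exists_perturbed_transport`). On
the top, a path missing `C` keeps its holonomy, and a path crossing `C` once picks up `f` of the
holonomy around `C` to the power `ε` (`hol_crossing`). Formulas 1 to 3 follow by applying this to
`E` and to `γ`.

The value of `Phi`. The top restriction must depend only on the bottom one, up to conjugacy.
Vertical transport on either side of the solid torus intertwines bottom and top; the two sides
differ by the meridian, hence, by the perturbation condition, by `f` of a holonomy already visible
on the bottom (`sideHol_one_eq`). A gauge equivalence of the bottoms can thus be carried to the tops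
(`hol_top_eq`), which gives `restrictTop_factorsThrough`. -/

/-- A homotopy invariant parallel transport along the paths of `X` with values in `G`, that is, a
functor from the fundamental groupoid of `X` to `G`. -/
structure Transport (X G : Type*) [TopologicalSpace X] [Group G] where
  hol : ∀ {a b : X}, Path a b → G
  hol_trans : ∀ {a b c : X} (p : Path a b) (q : Path b c), hol (p.trans q) = hol p * hol q
  hol_congr : ∀ {a b : X} {p q : Path a b}, p.Homotopic q → hol p = hol q

instance : ContractibleSpace I :=
  (convex_Icc (0 : ℝ) 1).contractibleSpace ⟨0, by simp⟩

/-- The straight path from `s` to `t` in the unit interval. -/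
def segPath (s t : I) : Path s t :=
  (⟨⟨id, continuous_id⟩, rfl, rfl⟩ : Path (0 : I) 1).subpath s t

theorem segPath_mem_Icc {s t : I} (h : s ≤ t) (r : I) : segPath s t r ∈ Set.Icc s t := by
  have := Path.range_subpath_of_le (⟨⟨id, continuous_id⟩, rfl, rfl⟩ : Path (0 : I) 1) s t h
  have h2 : segPath s t r ∈ Set.range (segPath s t) := ⟨r, rfl⟩
  unfold segPath at h2 ⊢
  rw [this] at h2
  simpa using h2

theorem segPath_zero_one (t : I) : segPath 0 1 t = t := by
  simp [segPath, Path.subpath]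

section loops
variable {X : Type*} [TopologicalSpace X] {x : X}

theorem loopClass_surjective (a : Pi1 X x) : ∃ p : Path x x, loopClass p = a := by
  obtain ⟨p, hp⟩ := Path.Homotopic.Quotient.mk_surjective (x₀ := x) (x₁ := x) a.unop
  exact ⟨p, congrArg MulOpposite.op hp⟩

theorem loopClass_congr {p q : Path x x} (h : p.Homotopic q) : loopClass p = loopClass q :=
  congrArg MulOpposite.op (Path.Homotopic.Quotient.eq.2 h)

end loops

namespace Transport

variable {X Y Z G : Type*} [TopologicalSpace X] [TopologicalSpace Y] [TopologicalSpace Z] [Group G]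
  (R : Transport X G)

theorem hol_refl (a : X) : R.hol (Path.refl a) = 1 := by
  have h := R.hol_trans (Path.refl a) (Path.refl a)
  rw [Path.refl_trans_refl] at h
  simpa using h

theorem hol_symm {a b : X} (p : Path a b) : R.hol p.symm = (R.hol p)⁻¹ := by
  rw [eq_comm, inv_eq_iff_mul_eq_one, ← R.hol_trans, ← R.hol_refl a]
  exact R.hol_congr ⟨(Path.Homotopy.reflTransSymm p).symm⟩

/-- The endpoints are only required to agree propositionally, as forced by pointwise equality; this
absorbs the casts of paths later on. -/
theorem hol_ext {a b a' b' : X} {p : Path a b} {q : Path a' b'} (h : ∀ t, p t = q t) :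
    R.hol p = R.hol q := by
  obtain rfl : a = a' := by simpa using h 0
  obtain rfl : b = b' := by simpa using h 1
  congr 1
  ext t
  exact h t

theorem hol_cast {a b a' b' : X} (p : Path a b) (ha : a' = a) (hb : b' = b) :
    R.hol (p.cast ha hb) = R.hol p :=
  R.hol_ext fun _ => rfl

theorem hol_eq_one_of_const {a b : X} {p : Path a b} (h : ∀ t, p t = a) : R.hol p = 1 := by
  rw [← R.hol_refl a]
  exact R.hol_ext h

theorem hol_connect {a b : X} (p : Path a b) (q : Path b b) :
    R.hol (connect p q) = R.hol p * R.hol q * (R.hol p)⁻¹ := by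
  rw [connect, R.hol_trans, R.hol_trans, R.hol_symm]

/-- The transport along the image in `X` of any path from `P` to `Q` in a simply connected space. -/
def along [SimplyConnectedSpace Y] (f : C(Y, X)) (P Q : Y) : G :=
  R.hol ((PathConnectedSpace.somePath P Q).map f.continuous)

section
variable [SimplyConnectedSpace Y] [SimplyConnectedSpace Z] (f : C(Y, X))

/-- Paths in `Y` with common ends are homotopic, so a path that lifts through `f` has a holonomy
depending only on the ends of its lift. -/
theorem hol_eq_along {a b : X} {p : Path a b} {P Q : Y} (w : Path P Q) (h : ∀ t, p t = f (w t)) :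
    R.hol p = R.along f P Q := by
  rw [along, R.hol_congr ((SimplyConnectedSpace.paths_homotopic _ w).map f)]
  exact R.hol_ext h

theorem along_mul (P Q S : Y) : R.along f P Q * R.along f Q S = R.along f P S := by
  rw [along, along, ← R.hol_trans, ← Path.map_trans]
  exact R.hol_eq_along f _ fun t => rfl

theorem along_self (P : Y) : R.along f P P = 1 := by
  simpa using R.along_mul f P P P

theorem along_inv (P Q : Y) : (R.along f P Q)⁻¹ = R.along f Q P := by
  rw [inv_eq_iff_mul_eq_one, R.along_mul, R.along_self]

theorem along_comp (k : C(Z, Y)) (P Q : Z) :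
    R.along (f.comp k) P Q = R.along f (k P) (k Q) :=
  R.hol_eq_along f ((PathConnectedSpace.somePath P Q).map k.continuous) fun _ => rfl

theorem along_translate (k : C(Y, Y)) (h : ∀ y, f (k y) = f y) (P Q : Y) :
    R.along f (k P) (k Q) = R.along f P Q := by
  rw [← R.along_comp]
  congr 1
  ext y
  exact h y

end

theorem hol_eq_along_self {a b : X} (p : Path a b) : R.hol p = R.along (p : C(I, X)) 0 1 :=
  R.hol_eq_along (p : C(I, X)) (segPath 0 1) fun t => by simp [segPath_zero_one]

theorem hol_subpath {a b : X} (p : Path a b) (s t : I) :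
    R.hol (p.subpath s t) = R.along (p : C(I, X)) s t :=
  R.hol_eq_along (p : C(I, X)) (segPath s t) fun _ => rfl

/-- The pull-back of a transport. -/
def comap (f : C(Y, X)) : Transport Y G where
  hol p := R.hol (p.map f.continuous)
  hol_trans p q := by rw [Path.map_trans, R.hol_trans]
  hol_congr h := R.hol_congr (h.map f)

/-- The representation of the fundamental group given by the transport along loops. -/
def toHom (x : X) : Pi1 X x →* G where
  toFun a := Quotient.lift (s := Path.Homotopic.setoid x x) (fun p => R.hol p)
    (fun _ _ h => R.hol_congr h) a.unop
  map_one' := R.hol_refl x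
  map_mul' a b := by
    obtain ⟨p, rfl⟩ := loopClass_surjective a
    obtain ⟨q, rfl⟩ := loopClass_surjective b
    exact R.hol_trans p q

theorem toHom_loopClass {x : X} (p : Path x x) : R.toHom x (loopClass p) = R.hol p := rfl

open Classical in
/-- Every representation of the fundamental group is given by a transport. -/
theorem exists_of_hom {x : X} (ρ : Pi1 X x →* G) :
    ∃ R : Transport X G, ∀ p : Path x x, R.hol p = ρ (loopClass p) := by
  let δ : ∀ a : X, Joined x a → Path x a := fun a h => h.some
  let h₀ : Joined x x := Joined.refl x
  -- The chosen path from `x` to itself need not be constant. Conjugation by `c` undoes its effect,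
  -- so that loops at `x` get exactly `ρ`.
  let c : G := ρ (loopClass (δ x h₀))
  have hj : ∀ {a b : X}, Path a b → Joined x a → Joined x b := fun p h => h.trans ⟨p⟩
  have key : ∀ {a b d : X} (u : Path x a) (p : Path a b) (v : Path x b) (q : Path b d)
      (w : Path x d), ρ (loopClass ((u.trans (p.trans q)).trans w.symm)) =
      ρ (loopClass ((u.trans p).trans v.symm)) * ρ (loopClass ((v.trans q).trans w.symm)) := by
    intro a b d u p v q w
    rw [← map_mul, ← loopClass_trans]
    congr 1
    apply loopClass_congr
    rw [← Path.Homotopic.Quotient.eq]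
    simp only [Path.Homotopic.Quotient.mk_trans, Path.Homotopic.Quotient.mk_symm,
      Path.Homotopic.Quotient.trans_assoc]
    congr 2
    rw [← Path.Homotopic.Quotient.trans_assoc (Path.Homotopic.Quotient.symm _)]
    simp
  let T : Transport X G :=
    { hol := fun {a b} p => if h : Joined x a then
        c⁻¹ * ρ (loopClass (((δ a h).trans p).trans (δ b (hj p h)).symm)) * c else 1
      hol_trans := by
        intro a b d p q
        by_cases h : Joined x a
        · rw [dif_pos h, dif_pos h, dif_pos (hj p h), key _ p (δ b (hj p h))]
          group
        · have h' : ¬ Joined x b := fun h' => h (h'.trans ⟨p.symm⟩)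
          rw [dif_neg h, dif_neg h, dif_neg h', one_mul]
      hol_congr := by
        intro a b p q hpq
        by_cases h : Joined x a
        · rw [dif_pos h, dif_pos h]
          congr 3
          exact loopClass_congr (((Path.Homotopic.refl _).hcomp hpq).hcomp (Path.Homotopic.refl _))
        · rw [dif_neg h, dif_neg h] }
  refine ⟨T, fun p => ?_⟩
  have h1 : T.hol p = c⁻¹ * ρ (loopClass (((δ x h₀).trans p).trans (δ x h₀).symm)) * c :=
    dif_pos h₀
  have h2 : loopClass (δ x h₀).symm = (loopClass (δ x h₀))⁻¹ := by
    rw [eq_comm, inv_eq_iff_mul_eq_one, ← loopClass_trans]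
    exact loopClass_congr ⟨(Path.Homotopy.reflTransSymm (δ x h₀)).symm⟩
  rw [h1, loopClass_trans, loopClass_trans, h2, map_mul, map_mul, map_inv]
  change c⁻¹ * (c * _ * c⁻¹) * c = _
  group

/-! ### Local determination and gluing of transports -/

theorem exists_partition {ι : Type*} {U : ι → Set X} (hU : ∀ i, IsOpen (U i))
    (w : C(I, X)) (hw : ∀ t, ∃ i, w t ∈ U i) :
    ∃ t : ℕ → I, t 0 = 0 ∧ Monotone t ∧ (∃ n, t n = 1) ∧
      ∀ n, ∃ i, ∀ r ∈ Set.Icc (t n) (t (n + 1)), w r ∈ U i := by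
  obtain ⟨t, h0, hm, ⟨n, hn⟩, ht⟩ := exists_monotone_Icc_subset_open_cover_unitInterval
    (c := fun i => w ⁻¹' U i) (fun i => (hU i).preimage w.continuous)
    (fun r _ => Set.mem_iUnion.2 (hw r))
  exact ⟨t, h0, hm, ⟨n, hn n le_rfl⟩, ht⟩

/-- Two transports which are locally related by a gauge transformation are globally related. -/
theorem hol_eq_of_locally {ι : Type*} {U : ι → Set X} (hU : ∀ i, IsOpen (U i))
    (S : Transport X G) (c : X → G)
    (h : ∀ i {a b : X} (p : Path a b), (∀ t, p t ∈ U i) → S.hol p = (c a)⁻¹ * R.hol p * c b)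
    {a b : X} (p : Path a b) (hp : ∀ t, ∃ i, p t ∈ U i) :
    S.hol p = (c a)⁻¹ * R.hol p * c b := by
  obtain ⟨t, h0, hm, ⟨n, hn⟩, ht⟩ := exists_partition hU (p : C(I, X)) hp
  -- On each piece of the partition the relation is local; the gauge factors at the division points
  -- cancel.
  have key : ∀ n, S.along (p : C(I, X)) 0 (t n) =
      (c (p 0))⁻¹ * R.along (p : C(I, X)) 0 (t n) * c (p (t n)) := by
    intro n
    induction n with
    | zero => rw [h0, along_self, along_self]; group
    | succ n ih =>
      obtain ⟨i, hi⟩ := ht n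
      have h1 := h i (p.subpath (t n) (t (n + 1))) fun r =>
        hi _ (segPath_mem_Icc (hm n.le_succ) r)
      rw [hol_subpath, hol_subpath] at h1
      rw [← S.along_mul _ 0 (t n), ih, h1, ← R.along_mul _ 0 (t n) (t (n + 1))]
      group
  have := key n
  rw [hn] at this
  rw [hol_eq_along_self, hol_eq_along_self, this]
  simp

section gluing

variable {ι : Type*} (U : ι → Set X) (g : ι → X → G)

/-- A section of the bundle glued from the gauge transforms of `R` by `g i` over `U i` which is
flat along `w`. -/
def IsFlatSection (w : C(I, X)) (θ : I → G) : Prop :=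
  ∀ i s t, s ≤ t → (∀ r ∈ Set.Icc s t, w r ∈ U i) →
    θ t = θ s * (g i (w s) * R.along w s t * (g i (w t))⁻¹)

variable {U g}

theorem IsFlatSection.unique (hU : ∀ i, IsOpen (U i)) {w : C(I, X)} (hw : ∀ t, ∃ i, w t ∈ U i)
    {θ θ' : I → G} (h : R.IsFlatSection U g w θ) (h' : R.IsFlatSection U g w θ')
    (h0 : θ 0 = θ' 0) : θ 1 = θ' 1 := by
  obtain ⟨t, ht0, hm, ⟨n, hn⟩, ht⟩ := exists_partition hU w hw
  have key : ∀ n, θ (t n) = θ' (t n) := by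
    intro n
    induction n with
    | zero => rw [ht0, h0]
    | succ n ih =>
      obtain ⟨i, hi⟩ := ht n
      rw [h i _ _ (hm n.le_succ) hi, h' i _ _ (hm n.le_succ) hi, ih]
  simpa [hn] using key n

variable (hg : ∀ i j {a b : X} (p : Path a b), (∀ t, p t ∈ U i ∩ U j) →
  g i a * R.hol p * (g i b)⁻¹ = g j a * R.hol p * (g j b)⁻¹)
include hg

theorem gauge_along_eq [SimplyConnectedSpace Y] (f : C(Y, X)) {P Q : Y} (w : Path P Q) {i j : ι}
    (hw : ∀ t, f (w t) ∈ U i ∩ U j) :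
    g i (f P) * R.along f P Q * (g i (f Q))⁻¹ = g j (f P) * R.along f P Q * (g j (f Q))⁻¹ := by
  have := hg i j (w.map f.continuous) hw
  rwa [R.hol_eq_along f w fun _ => rfl] at this

/-- The section is continued over one piece of a partition at a time. The compatibility `hg` makes
the continuation flat for every set of the cover containing the path there, not just for the one
chosen on that piece. -/
theorem exists_isFlatSection (hU : ∀ i, IsOpen (U i)) (w : C(I, X)) (hw : ∀ t, ∃ i, w t ∈ U i) :
    ∃ θ, θ 0 = 1 ∧ R.IsFlatSection U g w θ := by
  obtain ⟨t, ht0, hm, ⟨n, hn⟩, ht⟩ := exists_partition hU w hw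
  choose i hi using ht
  have cmp : ∀ {j k s r}, s ≤ r → (∀ q ∈ Set.Icc s r, w q ∈ U j) → (∀ q ∈ Set.Icc s r, w q ∈ U k) →
      g j (w s) * R.along w s r * (g j (w r))⁻¹ = g k (w s) * R.along w s r * (g k (w r))⁻¹ :=
    fun hsr h1 h2 => R.gauge_along_eq hg w (segPath _ _) fun q =>
      ⟨h1 _ (segPath_mem_Icc hsr q), h2 _ (segPath_mem_Icc hsr q)⟩
  have key : ∀ n, ∃ θ : I → G, θ 0 = 1 ∧ ∀ j s r, s ≤ r → r ≤ t n →
      (∀ q ∈ Set.Icc s r, w q ∈ U j) →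
      θ r = θ s * (g j (w s) * R.along w s r * (g j (w r))⁻¹) := by
    intro n
    induction n with
    | zero =>
      refine ⟨fun _ => 1, rfl, fun j s r hsr hr _ => ?_⟩
      obtain rfl : s = r := le_antisymm hsr (hr.trans (by rw [ht0]; exact nonneg'))
      rw [along_self]; group
    | succ n ih =>
      obtain ⟨θ, hθ0, hθ⟩ := ih
      refine ⟨fun r => if r ≤ t n then θ r else
        θ (t n) * (g (i n) (w (t n)) * R.along w (t n) r * (g (i n) (w r))⁻¹), ?_, ?_⟩
      · beta_reduce
        rw [if_pos nonneg', hθ0]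
      · intro j s r hsr hr hj
        beta_reduce
        by_cases h1 : r ≤ t n
        · rw [if_pos h1, if_pos (hsr.trans h1)]
          exact hθ j s r hsr h1 hj
        · have h1' := (not_le.1 h1).le
          rw [if_neg h1]
          by_cases h2 : s ≤ t n
          · rw [if_pos h2, hθ j s (t n) h2 le_rfl fun q hq => hj q ⟨hq.1, hq.2.trans h1'⟩,
              ← cmp h1' (fun q hq => hj q ⟨h2.trans hq.1, hq.2⟩)
                (fun q hq => hi n q ⟨hq.1, hq.2.trans hr⟩), ← R.along_mul w s (t n) r]
            group
          · have h2' := (not_le.1 h2).le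
            rw [if_neg h2, cmp hsr hj (fun q hq => hi n q ⟨h2'.trans hq.1, hq.2.trans hr⟩),
              ← R.along_mul w (t n) s r]
            group
  obtain ⟨θ, hθ0, hθ⟩ := key n
  exact ⟨θ, hθ0, fun j s r hsr hj => hθ j s r hsr (by rw [hn]; exact le_one') hj⟩

/-- Two neighboring rows of a homotopy are compared along the short edges joining them at the times
`t m`. Each small rectangle lies in one set of the cover, so the comparison passes from edge to
edge. The first and last edges are constant because the homotopy fixes endpoints. -/
theorem IsFlatSection.eq_of_strip (F : C(I × I, X)) {s s' : I} (hs : s ≤ s')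
    {t : ℕ → I} (ht0 : t 0 = 0) (hm : Monotone t) {n : ℕ} (hn : t n = 1)
    (ht : ∀ m, ∃ i, Set.Icc s s' ×ˢ Set.Icc (t m) (t (m + 1)) ⊆ F ⁻¹' U i)
    (hF0 : ∀ r, F (r, 0) = F (0, 0)) (hF1 : ∀ r, F (r, 1) = F (0, 1)) {θ θ' : I → G}
    (h : R.IsFlatSection U g (F.comp ((ContinuousMap.const I s).prodMk (.id I))) θ)
    (h' : R.IsFlatSection U g (F.comp ((ContinuousMap.const I s').prodMk (.id I))) θ')
    (h0 : θ 0 = θ' 0) : θ 1 = θ' 1 := by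
  choose i hi using ht
  have hedge : ∀ r : I, (∀ q, F (q, r) = F (0, r)) → R.along F (s, r) (s', r) = 1 := by
    intro r hr
    rw [← R.hol_eq_along F ((segPath s s').prod (Path.refl r)) (p :=
      ((segPath s s').prod (Path.refl r)).map F.continuous) fun _ => rfl]
    apply hol_eq_one_of_const
    intro q
    simp only [Path.map_coe, Function.comp_apply, Path.prod_coe, Path.refl_apply]
    rw [hr, hr s]
  have key : ∀ m, θ' (t m) = θ (t m) *
      (g (i m) (F (s, t m)) * R.along F (s, t m) (s', t m) * (g (i m) (F (s', t m)))⁻¹) := by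
    intro m
    induction m with
    | zero => rw [ht0, hedge 0 hF0, hF0 s, hF0 s', h0]; group
    | succ m ih =>
      have hmm := hm m.le_succ
      have e1 := h (i m) _ _ hmm fun r hr => hi m ⟨⟨le_rfl, hs⟩, hr⟩
      have e2 := h' (i m) _ _ hmm fun r hr => hi m ⟨⟨hs, le_rfl⟩, hr⟩
      rw [R.along_comp] at e1 e2
      change θ (t (m + 1)) = θ (t m) * (g (i m) (F (s, t m)) *
        R.along F (s, t m) (s, t (m + 1)) * (g (i m) (F (s, t (m + 1))))⁻¹) at e1
      change θ' (t (m + 1)) = θ' (t m) * (g (i m) (F (s', t m)) *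
        R.along F (s', t m) (s', t (m + 1)) * (g (i m) (F (s', t (m + 1))))⁻¹) at e2
      -- The edge at `t (m + 1)` lies in the sets of both adjacent rectangles, so the gauge index
      -- may be switched on it.
      have e3 := R.gauge_along_eq hg F ((segPath s s').prod (Path.refl (t (m + 1))))
        (i := i m) (j := i (m + 1)) fun r =>
          ⟨hi m ⟨segPath_mem_Icc hs r, hmm, le_rfl⟩,
            hi (m + 1) ⟨segPath_mem_Icc hs r, le_rfl, hm (m + 1).le_succ⟩⟩
      rw [e2, ← e3, e1, ih]
      have e4 : R.along F (s, t m) (s', t m) * R.along F (s', t m) (s', t (m + 1)) =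
          R.along F (s, t m) (s, t (m + 1)) * R.along F (s, t (m + 1)) (s', t (m + 1)) := by
        rw [R.along_mul, R.along_mul]
      simp only [mul_assoc, inv_mul_cancel_left]
      rw [← mul_assoc (R.along F _ _), e4, mul_assoc]
  have := key n
  rw [hn, hedge 1 hF1, hF1 s, hF1 s'] at this
  rw [this]; group

/-- Gluing of transports: gauge transforms of a transport over the sets of an open cover that agree
on the intersections come from a transport. -/
theorem exists_glue (hU : ∀ i, IsOpen (U i)) (hcov : ∀ a, ∃ i, a ∈ U i) :
    ∃ T : Transport X G, ∀ i {a b : X} (p : Path a b), (∀ t, p t ∈ U i) →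
      T.hol p = g i a * R.hol p * (g i b)⁻¹ := by
  -- The glued holonomy of a path is the value at time `1` of the flat section that starts at `1`.
  choose θ hθ0 hθ using fun w : C(I, X) => R.exists_isFlatSection hg hU w fun t => hcov (w t)
  refine ⟨{ hol := fun p => θ (p : C(I, X)) 1, hol_trans := ?_, hol_congr := ?_ }, ?_⟩
  · intro a b c p q
    let k₁ : C(I, I) := ⟨fun t => ⟨t / 2, div_mem t.2.1 (by norm_num) (by linarith [t.2.2])⟩,
      by fun_prop⟩
    let k₂ : C(I, I) := ⟨fun t => ⟨(t + 1) / 2,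
      div_mem (by linarith [t.2.1]) (by norm_num) (by linarith [t.2.2])⟩, by fun_prop⟩
    have e₁ : ((p.trans q : Path a c) : C(I, X)).comp k₁ = (p : C(I, X)) := by
      ext t
      have : (t : ℝ) / 2 ≤ 1 / 2 := by linarith [t.2.2]
      simp only [ContinuousMap.comp_apply, Path.trans_apply, k₁,
        ContinuousMap.coe_mk, this, dif_pos]
      congr 1; ext; simp; ring
    have e₂ : ((p.trans q : Path a c) : C(I, X)).comp k₂ = (q : C(I, X)) := by
      ext t
      simp only [ContinuousMap.comp_apply, Path.trans_apply, k₂,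
        ContinuousMap.coe_mk]
      split_ifs with h
      · have h' : (t : ℝ) = 0 := le_antisymm (by linarith) t.2.1
        obtain rfl : t = 0 := Subtype.ext h'
        rw [q.source]
        convert p.target
        simp
      · congr 1; ext; simp; ring
    -- Flat sections survive monotone reparametrization and left multiplication by a constant; `hk'`
    -- says that `k` skips no point between `k s` and `k t`. This is applied to the two halves of a
    -- concatenation.
    have sub : ∀ (k : C(I, I)), Monotone k → (∀ s t r, r ∈ Set.Icc (k s) (k t) →
        ∃ q ∈ Set.Icc s t, k q = r) → ∀ (w : C(I, X)) (α : I → G) (c : G),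
        R.IsFlatSection U g w α → R.IsFlatSection U g (w.comp k) fun t => c * α (k t) := by
      intro k hk hk' w α c hα i s t hst h
      beta_reduce
      rw [hα i (k s) (k t) (hk hst) fun r hr => ?_, R.along_comp]
      · simp only [ContinuousMap.comp_apply, mul_assoc]
      · obtain ⟨q, hq, rfl⟩ := hk' _ _ _ hr
        exact h q hq
    have s₁ := sub k₁ (fun s t h => by
        have h : (s : ℝ) ≤ t := h
        change (s : ℝ) / 2 ≤ t / 2
        linarith) (fun s t r hr => by
        have h1 : (s : ℝ) / 2 ≤ r := hr.1
        have h2 : (r : ℝ) ≤ t / 2 := hr.2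
        refine ⟨⟨2 * r, by linarith [s.2.1], by linarith [t.2.2]⟩, ⟨?_, ?_⟩, ?_⟩
        · change (s : ℝ) ≤ 2 * r; linarith
        · change 2 * (r : ℝ) ≤ t; linarith
        · ext; change 2 * (r : ℝ) / 2 = r; ring) _ _ 1 (hθ (p.trans q : Path a c))
    have s₂ := sub k₂ (fun s t h => by
        have h : (s : ℝ) ≤ t := h
        change ((s : ℝ) + 1) / 2 ≤ (t + 1) / 2
        linarith) (fun s t r hr => by
        have h1 : ((s : ℝ) + 1) / 2 ≤ r := hr.1
        have h2 : (r : ℝ) ≤ (t + 1) / 2 := hr.2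
        refine ⟨⟨2 * r - 1, by linarith [s.2.1], by linarith [t.2.2]⟩, ⟨?_, ?_⟩, ?_⟩
        · change (s : ℝ) ≤ 2 * r - 1; linarith
        · change 2 * (r : ℝ) - 1 ≤ t; linarith
        · ext; change (2 * (r : ℝ) - 1 + 1) / 2 = r; ring) _ _
        (θ (p.trans q : Path a c) (k₁ 1))⁻¹ (hθ (p.trans q : Path a c))
    have hk₁0 : k₁ 0 = 0 := by ext; simp [k₁]
    have hk₁1 : k₁ 1 = k₂ 0 := by ext; simp [k₁, k₂]
    have hk₂1 : k₂ 1 = 1 := by ext; simp [k₂]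
    have u₁ := s₁.unique R hU (fun t => hcov _) (e₁ ▸ hθ (p : C(I, X)))
      (by rw [hk₁0, hθ0, hθ0, one_mul])
    have u₂ := s₂.unique R hU (fun t => hcov _) (e₂ ▸ hθ (q : C(I, X)))
      (by rw [← hk₁1, hθ0, inv_mul_cancel])
    rw [e₁] at u₁
    rw [e₂, hk₂1] at u₂
    rw [← u₁, ← u₂]
    group
  · intro a b p q ⟨F⟩
    obtain ⟨t, ht0, hm, ⟨n, hn⟩, ht⟩ :=
      exists_monotone_Icc_subset_open_cover_unitInterval_prod_self
      (c := fun i => F ⁻¹' U i) (fun i => (hU i).preimage F.continuous)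
      (fun r _ => Set.mem_iUnion.2 (hcov (F r)))
    let row : I → C(I, X) := fun s =>
      (F : C(I × I, X)).comp ((ContinuousMap.const I s).prodMk (.id I))
    have hrow : ∀ m, θ (row 0) 1 = θ (row (t m)) 1 := by
      intro m
      induction m with
      | zero => rw [ht0]
      | succ m ih =>
        rw [ih]
        refine IsFlatSection.eq_of_strip R hg (F : C(I × I, X)) (hm m.le_succ) ht0 hm
          (hn n le_rfl) (ht m) ?_ ?_ (hθ _) (hθ _) (by rw [hθ0, hθ0])
        · intro r; exact (F.source r).trans (F.source 0).symm
        · intro r; exact (F.target r).trans (F.target 0).symm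
    have h0 : row 0 = (p : C(I, X)) := by ext r; exact F.map_zero_left r
    have h1 : row 1 = (q : C(I, X)) := by ext r; exact F.map_one_left r
    have := hrow n
    rwa [hn n le_rfl, h0, h1] at this
  · intro i a b p hp
    have := hθ (p : C(I, X)) i 0 1 nonneg' fun r _ => hp r
    change θ (p : C(I, X)) 1 = _
    rw [this, hθ0, ← R.hol_eq_along_self]
    simp

end gluing

end Transport
end CylinderPert

namespace CylinderPert

/-! ### The annulus covered by a collar -/

open Filter Topology

theorem cross_combination (v w : EuclideanSpace ℝ (Fin 2)) (a b : ℝ) :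
    cross (a • v + b • w) v = -(b * cross v w) := by
  simp [cross]; ring

namespace PertTube

variable {F : Type*} [TopologicalSpace F] [ChartedSpace (EuclideanSpace ℝ (Fin 2)) F]
  {C : EmbeddedCircle F} {x : F} (N : PertTube C x)

theorem collar_add_int (s u : ℝ) (n : ℤ) : N.collar (s + n, u) = N.collar (s, u) := by
  have : Function.Periodic (fun s => N.collar (s, u)) 1 := fun s => N.periodic s u
  simpa using this.int_mul n s

/-- The orientation condition makes the two partial derivatives a positive basis, so the derivative
is invertible; strictness prepares for the inverse function theorem. -/
theorem hasStrictFDerivAt_chart_collar [IsManifold (𝓡 2) ∞ F] (p : ℝ × ℝ) :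
    ∃ f' : (ℝ × ℝ) ≃L[ℝ] EuclideanSpace ℝ (Fin 2),
      HasStrictFDerivAt (fun q => chartAt (EuclideanSpace ℝ (Fin 2)) (N.collar p) (N.collar q))
        (f' : (ℝ × ℝ) →L[ℝ] EuclideanSpace ℝ (Fin 2)) p ∧
      0 < cross (f' (1, 0)) (f' (0, 1)) := by
  set f := fun q => chartAt (EuclideanSpace ℝ (Fin 2)) (N.collar p) (N.collar q) with hf
  have h1 : ContMDiffAt 𝓘(ℝ, ℝ × ℝ) 𝓘(ℝ, EuclideanSpace ℝ (Fin 2)) ∞ f p :=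
    (contMDiffAt_extChartAt (I := 𝓡 2) (n := ∞) (x := N.collar p)).comp p N.smooth.contMDiffAt
  have h2 : HasStrictFDerivAt f (fderiv ℝ f p) p :=
    h1.contDiffAt.hasStrictFDerivAt (by simp)
  have h3 : HasFDerivAt f (fderiv ℝ f p) p := h2.hasFDerivAt
  have e1 : deriv (fun s => f (s, p.2)) p.1 = fderiv ℝ f p (1, 0) := by
    have : HasDerivAt (fun s : ℝ => (s, p.2)) ((1 : ℝ), (0 : ℝ)) p.1 :=
      (hasDerivAt_id _).prodMk (hasDerivAt_const _ _)
    exact (h3.comp_hasDerivAt p.1 this).deriv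
  have e2 : deriv (fun u => f (p.1, u)) p.2 = fderiv ℝ f p (0, 1) := by
    have : HasDerivAt (fun u : ℝ => (p.1, u)) ((0 : ℝ), (1 : ℝ)) p.2 :=
      (hasDerivAt_const _ _).prodMk (hasDerivAt_id _)
    exact (h3.comp_hasDerivAt p.2 this).deriv
  have h4 : 0 < cross (fderiv ℝ f p (1, 0)) (fderiv ℝ f p (0, 1)) := by
    have := N.oriented p.1 p.2
    rw [crossSign, sign_eq_one_iff] at this
    rw [← e1, ← e2]
    exact this
  have hsplit : ∀ v : ℝ × ℝ, fderiv ℝ f p v =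
      v.1 • fderiv ℝ f p (1, 0) + v.2 • fderiv ℝ f p (0, 1) := by
    intro v
    rw [← map_smul, ← map_smul, ← map_add]
    congr 1
    ext <;> simp
  have hinj : Function.Injective (fderiv ℝ f p) := by
    rw [injective_iff_map_eq_zero]
    intro v hv
    rw [hsplit] at hv
    -- Cramer's rule: pairing a vanishing combination with either partial derivative isolates the
    -- other coefficient.
    have c1 := cross_combination (fderiv ℝ f p (1, 0)) (fderiv ℝ f p (0, 1)) v.1 v.2
    have c2 := cross_combination (fderiv ℝ f p (0, 1)) (fderiv ℝ f p (1, 0)) v.2 v.1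
    rw [add_comm] at c2
    rw [hv] at c1 c2
    have c0 : ∀ w, cross 0 w = 0 := fun w => by simp [cross]
    have c3 : cross (fderiv ℝ f p (0, 1)) (fderiv ℝ f p (1, 0)) =
      -cross (fderiv ℝ f p (1, 0)) (fderiv ℝ f p (0, 1)) := by simp only [cross]; ring
    rw [c0] at c1 c2
    rw [c3] at c2
    ext
    · simpa [h4.ne'] using c2
    · simpa [h4.ne'] using c1
  let f' : (ℝ × ℝ) ≃L[ℝ] EuclideanSpace ℝ (Fin 2) :=
    (LinearEquiv.ofInjectiveOfFinrankEq (fderiv ℝ f p : (ℝ × ℝ) →ₗ[ℝ] EuclideanSpace ℝ (Fin 2))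
      hinj (by simp)).toContinuousLinearEquiv
  have hf' : (f' : (ℝ × ℝ) →L[ℝ] EuclideanSpace ℝ (Fin 2)) = fderiv ℝ f p := by
    ext v <;> rfl
  refine ⟨f', hf' ▸ h2, ?_⟩
  have : ∀ v, f' v = fderiv ℝ f p v := fun v => congrArg (fun L => L v) hf'
  rw [this, this]
  exact h4

theorem isOpenMap_collar [IsManifold (𝓡 2) ∞ F] : IsOpenMap N.collar := by
  rw [isOpenMap_iff_nhds_le]
  intro p
  obtain ⟨f', hf, -⟩ := N.hasStrictFDerivAt_chart_collar p
  set e := chartAt (EuclideanSpace ℝ (Fin 2)) (N.collar p)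
  have hs : N.collar p ∈ e.source := mem_chart_source _ _
  have h1 : Filter.map (fun q => e (N.collar q)) (𝓝 p) = 𝓝 (e (N.collar p)) := hf.map_nhds_eq_of_equiv
  have h2 : Filter.map N.collar (𝓝 p) = Filter.map e.symm (Filter.map (fun q => e (N.collar q)) (𝓝 p)) := by
    rw [Filter.map_map]
    apply Filter.map_congr
    filter_upwards [N.smooth.continuous.continuousAt.preimage_mem_nhds (e.open_source.mem_nhds hs)]
      with q hq using (e.left_inv hq).symm
  rw [h2, h1, e.symm_map_nhds_eq hs]

/-- Lifting of paths through the collar, seen as a covering of its image. -/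
theorem exists_lift [IsManifold (𝓡 2) ∞ F] {a b : F} (w : Path a b)
    (hw : ∀ t, w t ∈ Set.range N.collar) (p : ℝ × ℝ) (hp : N.collar p = a) :
    ∃ (q : ℝ × ℝ) (v : Path p q), ∀ t, N.collar (v t) = w t := by
  have hper : ∀ u, Function.Periodic (fun s => N.collar (s, u)) 1 := fun u s => N.periodic s u
  -- The collar factors as the covering `π` of the annulus followed by an open embedding `j`. The
  -- path is first pulled back through `j`, then its circle coordinate is lifted to the line.
  let π : ℝ × ℝ → AddCircle (1 : ℝ) × ℝ := Prod.map (fun s => (s : AddCircle (1 : ℝ))) id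
  let j : AddCircle (1 : ℝ) × ℝ → F := fun y => (hper y.2).lift y.1
  have hπ : IsOpenQuotientMap π := QuotientAddGroup.isOpenQuotientMap_mk.prodMap .id
  have hj : j ∘ π = N.collar := by ext ⟨s, u⟩; rfl
  have hjc : Continuous j := hπ.isQuotientMap.continuous_iff.2 (hj ▸ N.smooth.continuous)
  have hjo : IsOpenMap j := by
    intro V hV
    rw [← Set.image_preimage_eq V hπ.surjective, ← Set.image_comp, hj]
    exact N.isOpenMap_collar _ (hV.preimage hπ.continuous)
  have hji : Function.Injective j := by
    intro y y' h
    obtain ⟨⟨s, u⟩, rfl⟩ := hπ.surjective y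
    obtain ⟨⟨s', u'⟩, rfl⟩ := hπ.surjective y'
    change N.collar (s, u) = N.collar (s', u') at h
    obtain ⟨h1, n, h2⟩ := N.injective _ _ _ _ h
    refine Prod.ext ?_ h1.symm
    change (s : AddCircle (1 : ℝ)) = (s' : AddCircle (1 : ℝ))
    rw [h2, AddCircle.coe_add, eq_comm, add_eq_left, AddCircle.coe_eq_zero_iff]
    exact ⟨n, by simp⟩
  have hje : IsOpenEmbedding j := .of_continuous_injective_isOpenMap hjc hji hjo
  have hr : ∀ t, w t ∈ Set.range j := fun t => by
    obtain ⟨q, hq⟩ := hw t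
    exact ⟨π q, by rw [← hq, ← hj]; rfl⟩
  choose w' hw' using hr
  have hwc : Continuous w' := by
    rw [hje.isInducing.continuous_iff]
    exact w.continuous.congr fun t => (hw' t).symm
  obtain ⟨Γ, hΓ, hΓ0⟩ := (AddCircle.isCoveringMap_coe (1 : ℝ)).exists_path_lifts
    ⟨fun t => (w' t).1, by fun_prop⟩ p.1 (by
      have : w' 0 = π p := hji (by rw [hw', w.source, ← hp, ← hj]; rfl)
      change (w' 0).1 = _
      rw [this]; rfl)
  refine ⟨(Γ 1, (w' 1).2), ⟨⟨fun t => (Γ t, (w' t).2), by fun_prop⟩, ?_, rfl⟩, fun t => ?_⟩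
  · have : w' 0 = π p := hji (by rw [hw', w.source, ← hp, ← hj]; rfl)
    change (Γ 0, (w' 0).2) = p
    rw [hΓ0, this]; rfl
  · change N.collar (Γ t, (w' t).2) = w t
    rw [← hw' t, ← hj]
    change j ((Γ t : AddCircle (1 : ℝ)), (w' t).2) = j (w' t)
    congr 1
    exact Prod.ext (congrFun hΓ t) rfl

/-- At a transverse crossing with `C`, the collar coordinate along a curve changes its sign. -/
theorem exists_collar_coordinate [IsManifold (𝓡 2) ∞ F] {w : ℝ → F} (hw : Continuous w) {t s : ℝ}
    (hts : w t = C s) {ε : ℤˣ} (hε : crossSign w C t s = SignType.sign (ε : ℤ)) :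
    ∃ q : ℝ → ℝ × ℝ, (∀ᶠ τ in 𝓝 t, N.collar (q τ) = w τ) ∧
      (∀ᶠ τ in 𝓝[<] t, 0 < (ε : ℤ) * (q τ).2) ∧ (∀ᶠ τ in 𝓝[>] t, (ε : ℤ) * (q τ).2 < 0) := by
  obtain ⟨f', hf, hpos⟩ := N.hasStrictFDerivAt_chart_collar (s, 0)
  have hb : N.collar (s, 0) = w t := by rw [N.core, hts]
  rw [hb] at hf
  rw [crossSign] at hε
  set e := chartAt (EuclideanSpace ℝ (Fin 2)) (w t)
  have hs : w t ∈ e.source := mem_chart_source _ _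
  have hC : deriv (fun r => e (C r)) s = f' (1, 0) := by
    have : HasDerivAt (fun s : ℝ => (s, (0 : ℝ))) ((1 : ℝ), (0 : ℝ)) s :=
      (hasDerivAt_id _).prodMk (hasDerivAt_const _ _)
    have := (hf.hasFDerivAt.comp_hasDerivAt s this).deriv
    rw [← ContinuousLinearEquiv.coe_coe, ← this]
    congr 1
    ext r : 1
    simp only [Function.comp_apply, N.core]
  rw [hC] at hε
  set v := deriv (fun τ => e (w τ)) t
  -- The curve is only assumed continuous. Since `deriv` is zero where there is no derivative, the
  -- nonzero crossing sign forces differentiability at `t`.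
  have hv0 : v ≠ 0 := by
    intro h
    rw [h] at hε
    rcases Int.units_eq_one_or ε with rfl | rfl <;> simp [cross] at hε
  have hd : HasDerivAt (fun τ => e (w τ)) v t :=
    (differentiableAt_of_deriv_ne_zero hv0).hasDerivAt
  let ψ := hf.localInverse
  have hfb : e (N.collar (s, 0)) = e (w t) := by rw [hb]
  have hψ0 : ψ (e (w t)) = (s, 0) := by
    rw [← hfb]
    exact hf.localInverse_apply_image
  have hψ : HasStrictFDerivAt ψ (f'.symm : EuclideanSpace ℝ (Fin 2) →L[ℝ] ℝ × ℝ) (e (w t)) := by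
    rw [← hfb]
    exact hf.to_localInverse
  have hew : ContinuousAt (fun τ => e (w τ)) t := hd.continuousAt
  have hq : ContinuousAt (fun τ => ψ (e (w τ))) t :=
    ContinuousAt.comp (g := ψ) (f := fun τ => e (w τ)) hψ.continuousAt hew
  have hqd : HasDerivAt (fun τ => ψ (e (w τ))) (f'.symm v) t :=
    HasFDerivAt.comp_hasDerivAt (f := fun τ => e (w τ)) t hψ.hasFDerivAt hd
  have hqd2 : HasDerivAt (fun τ => (ψ (e (w τ))).2) (f'.symm v).2 t :=
    (ContinuousLinearMap.snd ℝ ℝ ℝ).hasFDerivAt.comp_hasDerivAt t hqd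
  refine ⟨fun τ => ψ (e (w τ)), ?_, ?_⟩
  · have h1 : ∀ᶠ y in 𝓝 (e (w t)), e (N.collar (ψ y)) = y := by
      have := hf.eventually_right_inverse
      rwa [hfb] at this
    have h2 : ∀ᶠ τ in 𝓝 t, N.collar (ψ (e (w τ))) ∈ e.source := by
      have hc : ContinuousAt (fun τ => N.collar (ψ (e (w τ)))) t :=
        ContinuousAt.comp (g := N.collar) N.smooth.continuous.continuousAt hq
      apply hc.eventually_mem
      rw [hψ0, hb]
      exact e.open_source.mem_nhds hs
    have h3 : ∀ᶠ τ in 𝓝 t, w τ ∈ e.source :=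
      hw.continuousAt.eventually_mem (e.open_source.mem_nhds hs)
    filter_upwards [hew.eventually h1, h2, h3] with τ h1 h2 h3
    exact e.injOn h2 h3 h1
  · have hv : v = (f'.symm v).1 • f' (1, 0) + (f'.symm v).2 • f' (0, 1) := by
      rw [← map_smul, ← map_smul, ← map_add]
      conv_lhs => rw [← f'.apply_symm_apply v]
      congr 1
      ext <;> simp
    -- With `b` the collar velocity transverse to `C`, the crossing sign is the sign of `-b`. Thus
    -- `ε = 1` means passing from the left of `C`, where the second coordinate is positive, to the
    -- right.
    rw [hv, cross_combination] at hε
    set b := (f'.symm v).2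
    have hεb : ((ε : ℤ) : ℝ) * b < 0 := by
      rcases Int.units_eq_one_or ε with rfl | rfl
      · have : 0 < -(b * cross (f' (1, 0)) (f' (0, 1))) := by
          rw [← sign_eq_one_iff, hε]; simp
        have : b < 0 := by
          by_contra h
          nlinarith [mul_nonneg (not_lt.1 h) hpos.le]
        simpa using this
      · have : -(b * cross (f' (1, 0)) (f' (0, 1))) < 0 := by
          rw [← sign_eq_neg_one_iff, hε]; simp
        have := neg_lt_zero.1 this
        have : 0 < b := pos_of_mul_pos_left this hpos.le
        simpa using this
    have hz : ((ε : ℤ) : ℝ) * (ψ (e (w t))).2 = 0 := by rw [hψ0]; simp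
    have hdd := hqd2.const_mul ((ε : ℤ) : ℝ)
    have hsl := hasDerivAt_iff_tendsto_slope.1 hdd
    have hev := hsl.eventually_lt_const hεb
    rw [← nhdsLT_sup_nhdsGT, eventually_sup] at hev
    constructor
    · filter_upwards [hev.1, self_mem_nhdsWithin] with τ h1 h2
      have h2 : τ < t := h2
      rw [slope_def_field, hz, sub_zero, div_lt_iff_of_neg (by linarith)] at h1
      simpa using h1
    · filter_upwards [hev.2, self_mem_nhdsWithin] with τ h1 h2
      have h2 : t < τ := h2
      rw [slope_def_field, hz, sub_zero, div_lt_iff₀ (by linarith)] at h1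
      simpa using h1

end PertTube
end CylinderPert

namespace CylinderPert

/-! ### Conjugation equivariance of the perturbation map -/

theorem exists_eq_exp (g : SU2) :
    ∃ (α : ℝ) (Q : ℍ[ℝ]), IsUnitImag Q ∧ (g : ℍ[ℝ]) = NormedSpace.exp (α • Q) := by
  have h1 : Quaternion.normSq (g : ℍ[ℝ]) = 1 := by
    have : (g : ℍ[ℝ]) * star (g : ℍ[ℝ]) = 1 := Unitary.coe_mul_star_self g
    rw [Quaternion.self_mul_star] at this
    exact Quaternion.coe_injective (this.trans Quaternion.coe_one.symm)
  have h2 : (g : ℍ[ℝ]).re ^ 2 + ‖(g : ℍ[ℝ]).im‖ ^ 2 = 1 := by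
    rw [sq ‖_‖, ← Quaternion.normSq_eq_norm_mul_self]
    rw [Quaternion.normSq_def'] at h1 ⊢
    simp only [Quaternion.re_im, Quaternion.imI_im, Quaternion.imJ_im, Quaternion.imK_im]
    linarith
  have hs : Real.sin (Real.arccos (g : ℍ[ℝ]).re) = ‖(g : ℍ[ℝ]).im‖ := by
    rw [Real.sin_arccos, ← Real.sqrt_sq (norm_nonneg (g : ℍ[ℝ]).im)]
    congr 1
    linarith
  have hc : Real.cos (Real.arccos (g : ℍ[ℝ]).re) = (g : ℍ[ℝ]).re :=
    Real.cos_arccos (by nlinarith [sq_nonneg ‖(g : ℍ[ℝ]).im‖])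
      (by nlinarith [sq_nonneg ‖(g : ℍ[ℝ]).im‖])
  have key : ∃ Q : ℍ[ℝ], IsUnitImag Q ∧ ‖(g : ℍ[ℝ]).im‖ • Q = (g : ℍ[ℝ]).im := by
    by_cases h : (g : ℍ[ℝ]).im = 0
    -- Here `g` is central and has no axis of its own; any unit imaginary quaternion serves.
    · let i : ℍ[ℝ] := ⟨0, 1, 0, 0⟩
      refine ⟨i, ⟨rfl, ?_⟩, by rw [h, norm_zero, zero_smul]⟩
      rw [← sq_eq_sq₀ (norm_nonneg _) zero_le_one, sq, ← Quaternion.normSq_eq_norm_mul_self,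
        Quaternion.normSq_def']
      simp [i]
    · refine ⟨‖(g : ℍ[ℝ]).im‖⁻¹ • (g : ℍ[ℝ]).im, ⟨by simp, ?_⟩, ?_⟩
      · rw [norm_smul, norm_inv, norm_norm, inv_mul_cancel₀ (norm_ne_zero_iff.2 h)]
      · rw [smul_inv_smul₀ (norm_ne_zero_iff.2 h)]
  obtain ⟨Q, hQ, hQg⟩ := key
  refine ⟨Real.arccos (g : ℍ[ℝ]).re, Q, hQ, ?_⟩
  rw [exp_smul_unitImag hQ, hs, hc, hQg, Quaternion.re_add_im]

theorem IsUnitImag.conj {Q : ℍ[ℝ]} (hQ : IsUnitImag Q) (h : SU2) :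
    IsUnitImag ((h : ℍ[ℝ]) * Q * ((h⁻¹ : SU2) : ℍ[ℝ])) := by
  have hh : ((h⁻¹ : SU2) : ℍ[ℝ]) = star (h : ℍ[ℝ]) := rfl
  have hn : ∀ g : SU2, ‖(g : ℍ[ℝ])‖ = 1 := fun g => CStarRing.norm_coe_unitary g
  constructor
  · rw [← Quaternion.star_eq_neg, hh, star_mul, star_mul, star_star, Quaternion.star_eq_neg.2 hQ.1]
    simp [mul_assoc]
  · rw [norm_mul, norm_mul, hn, hn, hQ.2]; norm_num

theorem conj_exp_smul {Q : ℍ[ℝ]} (hQ : IsUnitImag Q) (h : SU2) (α : ℝ) :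
    (h : ℍ[ℝ]) * NormedSpace.exp (α • Q) * ((h⁻¹ : SU2) : ℍ[ℝ]) =
      NormedSpace.exp (α • ((h : ℍ[ℝ]) * Q * ((h⁻¹ : SU2) : ℍ[ℝ]))) := by
  have h1 : (h : ℍ[ℝ]) * ((h⁻¹ : SU2) : ℍ[ℝ]) = 1 := Unitary.coe_mul_star_self h
  rw [exp_smul_unitImag hQ, exp_smul_unitImag (hQ.conj h), mul_add, add_mul,
    ← (Quaternion.coe_commutes _ (h : ℍ[ℝ])), mul_assoc, h1, mul_one, mul_smul_comm, smul_mul_assoc]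

/-- Conjugation moves the axis `Q` and keeps the angle. This equivariance is all that the
construction and the uniqueness argument need to know about the perturbation map. -/
theorem pertMap_conj {k : ℕ} (φ : PertFun k) (h g : SU2) :
    pertMap φ (h * g * h⁻¹) = h * pertMap φ g * h⁻¹ := by
  obtain ⟨α, Q, hQ, hg⟩ := exists_eq_exp g
  apply Subtype.ext
  rw [pertMap_of_eq_exp φ (h * g * h⁻¹) (hQ.conj h) (α := α)]
  · change _ = (h : ℍ[ℝ]) * (pertMap φ g : ℍ[ℝ]) * ((h⁻¹ : SU2) : ℍ[ℝ])
    rw [pertMap_of_eq_exp φ g hQ hg, conj_exp_smul hQ]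
  · change (h : ℍ[ℝ]) * (g : ℍ[ℝ]) * ((h⁻¹ : SU2) : ℍ[ℝ]) = _
    rw [hg, conj_exp_smul hQ]

theorem coe_pertMap_zpow {k : ℕ} (φ : PertFun k) (g : SU2) {α : ℝ} {Q : ℍ[ℝ]}
    (hQ : IsUnitImag Q) (hg : (g : ℍ[ℝ]) = NormedSpace.exp (α • Q)) (ε : ℤˣ) :
    ((pertMap φ g ^ (ε : ℤ) : SU2) : ℍ[ℝ]) = NormedSpace.exp ((((ε : ℤ) : ℝ) * φ α) • Q) := by
  have h1 := pertMap_of_eq_exp φ g hQ hg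
  rcases Int.units_eq_one_or ε with rfl | rfl
  · simpa using h1
  · have h2 : ((pertMap φ g ^ ((-1 : ℤˣ) : ℤ) : SU2) : ℍ[ℝ]) = star (pertMap φ g : ℍ[ℝ]) := by
      simp only [Units.val_neg, Units.val_one, zpow_neg, zpow_one]
      rfl
    rw [h2, h1, exp_smul_unitImag hQ, exp_smul_unitImag hQ]
    simp [Quaternion.star_eq_neg.2 hQ.1]

/-! ### Holonomy of the annulus -/

namespace PertTube

variable {F : Type*} [TopologicalSpace F] [ChartedSpace (EuclideanSpace ℝ (Fin 2)) F]
  {C : EmbeddedCircle F} {x : F} (N : PertTube C x) {G : Type*} [Group G] (R : Transport F G)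

/-- The collar as a continuous map. -/
def collarMap : C(ℝ × ℝ, F) := ⟨N.collar, N.smooth.continuous⟩

theorem along_collarMap_add_int (p q : ℝ × ℝ) (n : ℤ) :
    R.along N.collarMap (p.1 + n, p.2) (q.1 + n, q.2) = R.along N.collarMap p q :=
  R.along_translate N.collarMap ⟨fun p => (p.1 + n, p.2), by fun_prop⟩
    (fun p => N.collar_add_int p.1 p.2 n) p q

/-- The holonomy around the parallel of `C` through `collar p`. -/
def circleHol (p : ℝ × ℝ) : G := R.along N.collarMap p (p.1 + 1, p.2)

/-- The quadrilateral with corners `p`, `q` and their translates by one period has trivial boundary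
holonomy, and its two sides joining `p` to `q` have equal transport by periodicity. -/
theorem circleHol_eq_conj (p q : ℝ × ℝ) :
    N.circleHol R p =
      R.along N.collarMap p q * N.circleHol R q * (R.along N.collarMap p q)⁻¹ := by
  have := N.along_collarMap_add_int R p q 1
  rw [Int.cast_one] at this
  rw [eq_mul_inv_iff_mul_eq, circleHol, circleHol]
  conv_lhs => rw [← this]
  rw [R.along_mul, R.along_mul]

theorem circleHol_add_int (p : ℝ × ℝ) (n : ℤ) :
    N.circleHol R (p.1 + n, p.2) = N.circleHol R p := by
  rw [circleHol, circleHol, ← N.along_collarMap_add_int R p _ n]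
  congr 2
  ring

theorem hol_loop (s : ℝ) : R.hol (C.loop s) = N.circleHol R (s, 0) := by
  let v : Path ((s, 0) : ℝ × ℝ) (s + 1, 0) :=
    ⟨⟨fun t => (s + t, 0), by fun_prop⟩, by simp, by simp⟩
  exact R.hol_eq_along N.collarMap v fun t => (N.core _).symm

variable (f : G → G)

open Classical in
/-- The gauge transformation which is `f` of the holonomy around `C` to the left of `C`, and trivial
to its right. -/
def leftGauge (y : F) : G :=
  if h : ∃ p : ℝ × ℝ, 0 < p.2 ∧ N.collar p = y then f (N.circleHol R h.choose) else 1

theorem leftGauge_of_pos {p : ℝ × ℝ} (hp : 0 < p.2) :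
    N.leftGauge R f (N.collar p) = f (N.circleHol R p) := by
  have h : ∃ q : ℝ × ℝ, 0 < q.2 ∧ N.collar q = N.collar p := ⟨p, hp, rfl⟩
  rw [leftGauge, dif_pos h]
  obtain ⟨h1, n, h2⟩ := N.injective _ _ _ _ (show N.collar (p.1, p.2) = N.collar
    (h.choose.1, h.choose.2) from h.choose_spec.2.symm)
  rw [← N.circleHol_add_int R p n]
  congr 2
  exact Prod.ext h2 h1

theorem leftGauge_of_nonpos {p : ℝ × ℝ} (hp : p.2 ≤ 0) : N.leftGauge R f (N.collar p) = 1 := by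
  rw [leftGauge, dif_neg]
  rintro ⟨q, hq, h⟩
  have := (N.injective q.1 q.2 p.1 p.2 h).1
  linarith

variable {f} (hf : ∀ h g, f (h * g * h⁻¹) = h * f g * h⁻¹)
include hf

theorem map_circleHol_eq_conj (p q : ℝ × ℝ) :
    f (N.circleHol R p) =
      R.along N.collarMap p q * f (N.circleHol R q) * (R.along N.collarMap p q)⁻¹ := by
  rw [N.circleHol_eq_conj R p q, hf]

/-- On either side of `C` the gauge is a flat section, by equivariance, so it changes no transport
between points on the same side. This is the compatibility needed for regluing. -/
theorem leftGauge_mul_along {p q : ℝ × ℝ} (h : 0 < p.2 ↔ 0 < q.2) :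
    N.leftGauge R f (N.collar p) * R.along N.collarMap p q * (N.leftGauge R f (N.collar q))⁻¹ =
      R.along N.collarMap p q := by
  by_cases hp : 0 < p.2
  · rw [N.leftGauge_of_pos R f hp, N.leftGauge_of_pos R f (h.1 hp),
      N.map_circleHol_eq_conj R hf p q]
    group
  · rw [N.leftGauge_of_nonpos R f (not_lt.1 hp),
      N.leftGauge_of_nonpos R f (not_lt.1 fun hq => hp (h.2 hq))]
    simp

end PertTube
end CylinderPert

namespace CylinderPert
namespace PertTube

/-! ### The exterior of the solid torus -/

open unitInterval

variable {F : Type*} [TopologicalSpace F] [ChartedSpace (EuclideanSpace ℝ (Fin 2)) F]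
  {C : EmbeddedCircle F} {x : F} (N : PertTube C x)

/-- Half of the width of the solid torus at level `t`. -/
def halfWidth (t : ℝ) : ℝ := √(1 - ((t - 1 / 2) / N.height) ^ 2)

theorem halfWidth_nonneg (t : ℝ) : 0 ≤ N.halfWidth t := Real.sqrt_nonneg _

theorem halfWidth_le_one (t : ℝ) : N.halfWidth t ≤ 1 := by
  rw [halfWidth, Real.sqrt_le_left zero_le_one]
  linarith [sq_nonneg ((t - 1 / 2) / N.height)]

theorem halfWidth_half : N.halfWidth (1 / 2) = 1 := by simp [halfWidth]

/-- Above and below the solid torus the radicand is nonpositive and `Real.sqrt` returns `0`, so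
nothing is pushed aside at those levels. -/
theorem halfWidth_eq_zero {t : ℝ} (h : N.height ≤ |t - 1 / 2|) : N.halfWidth t = 0 := by
  rw [halfWidth, Real.sqrt_eq_zero']
  have : 1 ≤ ((t - 1 / 2) / N.height) ^ 2 := by
    rw [one_le_sq_iff_one_le_abs, abs_div, abs_of_pos N.height_pos, one_le_div N.height_pos]
    exact h
  linarith

theorem continuous_halfWidth : Continuous N.halfWidth := by
  unfold halfWidth
  fun_prop

theorem mem_exterior {s y t : ℝ} (ht : t ∈ Set.Icc (0 : ℝ) 1) (h : N.halfWidth t ≤ |y|) :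
    (N.collar (s, y), t) ∈ N.exterior := by
  refine ⟨ht, fun s' z hz he => ?_⟩
  have h1 := (N.injective _ _ _ _ (congrArg Prod.fst he)).1
  have h2 : 1 / 2 + N.height * z.re = t := congrArg Prod.snd he
  have h3 : (t - 1 / 2) / N.height = z.re := by
    rw [← h2, add_sub_cancel_left, mul_div_cancel_left₀ _ N.height_pos.ne']
  rw [halfWidth, h3, h1, abs_neg, Real.sqrt_le_left (abs_nonneg _), sq_abs] at h
  have h4 : ‖z‖ ^ 2 < 1 := by nlinarith [norm_nonneg z]
  rw [Complex.sq_norm, Complex.normSq_apply] at h4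
  nlinarith

theorem mem_exterior_of_forall_ne {y : F} {t : ℝ} (ht : t ∈ Set.Icc (0 : ℝ) 1)
    (h : ∀ s u, |u| ≤ 1 → N.collar (s, u) ≠ y) : (y, t) ∈ N.exterior :=
  ⟨ht, fun s z hz he => h s (-z.im)
    (by rw [abs_neg]; exact (Complex.abs_im_le_norm z).trans hz.le) (congrArg Prod.fst he)⟩

theorem height_le_of_mem_exterior {s t : ℝ} (h : (N.collar (s, 0), t) ∈ N.exterior) :
    N.height ≤ |t - 1 / 2| := by
  by_contra hlt
  -- Over `C` itself the disk coordinate is real, and the level determines it.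
  refine h.2 s (((t - 1 / 2) / N.height : ℝ) : ℂ) ?_ ?_
  · rw [Complex.norm_real, Real.norm_eq_abs, abs_div, abs_of_pos N.height_pos,
      div_lt_one N.height_pos]
    exact not_le.1 hlt
  · have := N.height_pos.ne'
    simp only [map, Complex.ofReal_im, Complex.ofReal_re, neg_zero]
    congr 1
    field_simp
    ring

/-- The collar coordinates of `sideMap`: the strip `0 ≤ e * u` is pushed off the solid torus. -/
def sideCoord (e : ℤˣ) (t u : ℝ) : ℝ := (e : ℤ) * max ((e : ℤ) * u) (N.halfWidth t)

theorem abs_sideCoord (e : ℤˣ) (t u : ℝ) : N.halfWidth t ≤ |N.sideCoord e t u| := by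
  have h : |(((e : ℤ) : ℝ))| = 1 := by rcases Int.units_eq_one_or e with rfl | rfl <;> simp
  rw [sideCoord, abs_mul, h, one_mul]
  exact (le_max_right _ _).trans (le_abs_self _)

theorem sideCoord_of_le {e : ℤˣ} {t u : ℝ} (h : N.halfWidth t ≤ (e : ℤ) * u) :
    N.sideCoord e t u = u := by
  rw [sideCoord, max_eq_left h]
  rcases Int.units_eq_one_or e with rfl | rfl <;> simp

theorem sideCoord_zero (e : ℤˣ) (t : ℝ) : N.sideCoord e t 0 = (e : ℤ) * N.halfWidth t := by
  rw [sideCoord, mul_zero, max_eq_right (N.halfWidth_nonneg t)]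

/-- The part of the exterior over one side of `C`; it is simply connected after unwrapping `C`. -/
def sideMap (e : ℤˣ) : C((ℝ × ℝ) × I, N.exterior) where
  toFun p := ⟨(N.collar (p.1.1, N.sideCoord e p.2 p.1.2), p.2),
    N.mem_exterior p.2.2 (N.abs_sideCoord e _ _)⟩
  continuous_toFun := by
    have h1 := N.smooth.continuous
    have h2 := N.continuous_halfWidth
    unfold sideCoord
    fun_prop

/-- The projection of the exterior to the surface. -/
def proj : C(N.exterior, F) := ⟨fun q => q.1.1, by fun_prop⟩

/-- The level of the lower end of the solid torus. -/
def low : I := ⟨1 / 2 - N.height, by linarith [N.height_lt], by linarith [N.height_pos]⟩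

/-- The middle level. -/
def mid : I := ⟨1 / 2, by norm_num, by norm_num⟩

/-- The level of the upper end of the solid torus. -/
def high : I := ⟨1 / 2 + N.height, by linarith [N.height_pos], by linarith [N.height_lt]⟩

theorem low_le_mid : N.low ≤ mid := by
  change (1 / 2 - N.height : ℝ) ≤ 1 / 2
  linarith [N.height_pos]

theorem mid_le_high : mid ≤ N.high := by
  change (1 / 2 : ℝ) ≤ 1 / 2 + N.height
  linarith [N.height_pos]

theorem halfWidth_low : N.halfWidth N.low = 0 :=
  N.halfWidth_eq_zero (by
    change _ ≤ |1 / 2 - N.height - 1 / 2|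
    rw [show 1 / 2 - N.height - 1 / 2 = -N.height by ring, abs_neg]
    exact le_abs_self _)

theorem halfWidth_high : N.halfWidth N.high = 0 :=
  N.halfWidth_eq_zero (by
    change _ ≤ |1 / 2 + N.height - 1 / 2|
    rw [show 1 / 2 + N.height - 1 / 2 = N.height by ring]
    exact le_abs_self _)

theorem halfWidth_zero : N.halfWidth 0 = 0 :=
  N.halfWidth_eq_zero (by
    rw [zero_sub, abs_neg, abs_of_pos (by norm_num)]
    exact N.height_lt.le)

theorem halfWidth_one : N.halfWidth 1 = 0 :=
  N.halfWidth_eq_zero (by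
    rw [abs_of_pos (by norm_num)]
    linarith [N.height_lt])

section
variable {G : Type*} [Group G] (S : Transport N.exterior G)

/-- The disk coordinate `exp (2πit)` has collar coordinate `-sin (2πt)`: the meridian starts at the
upper end, descends on the right of `C` and returns on the left. -/
theorem hol_meridian : S.hol N.meridian =
    S.along (N.sideMap (-1)) ((0, 0), N.high) ((0, 0), N.low) *
      S.along (N.sideMap 1) ((0, 0), N.low) ((0, 0), N.high) := by
  have hh := N.height_pos
  have hbd : ∀ t : ℝ, 1 / 2 + N.height * Real.cos t ∈ Set.Icc (0 : ℝ) 1 := fun t => by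
    have := N.height_lt
    constructor <;> nlinarith [Real.cos_le_one t, Real.neg_one_le_cos t]
  -- At this level `sideMap` pushes the points over `C` out to the boundary circle of the solid
  -- torus, so its two sides trace the two halves of the meridian.
  have hw : ∀ t : ℝ, N.halfWidth (1 / 2 + N.height * Real.cos t) = |Real.sin t| := fun t => by
    rw [halfWidth, add_sub_cancel_left, mul_div_cancel_left₀ _ hh.ne', ← Real.sin_sq t,
      Real.sqrt_sq_eq_abs]
  let a : Path N.high N.low :=
    ⟨⟨fun t => ⟨1 / 2 + N.height * Real.cos (Real.pi * t), hbd _⟩, by fun_prop⟩,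
      by ext; simp [high], by ext; simp [low]; ring⟩
  let b : Path N.low N.high :=
    ⟨⟨fun t => ⟨1 / 2 + N.height * Real.cos (Real.pi * (1 + t)), hbd _⟩, by fun_prop⟩,
      by ext; simp [low]; ring, by ext; simp [high, mul_add, Real.cos_add_pi]⟩
  let a' := ((Path.refl ((0 : ℝ), (0 : ℝ))).prod a).map (N.sideMap (-1)).continuous
  let b' := ((Path.refl ((0 : ℝ), (0 : ℝ))).prod b).map (N.sideMap 1).continuous
  have hmid : N.sideMap (-1) ((0, 0), N.low) = N.sideMap 1 ((0, 0), N.low) := by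
    ext <;> simp [sideMap, sideCoord_zero, halfWidth_low]
  rw [← S.hol_eq_along (N.sideMap (-1)) ((Path.refl ((0 : ℝ), (0 : ℝ))).prod a) (p := a')
    fun _ => rfl, ← S.hol_eq_along (N.sideMap 1) ((Path.refl ((0 : ℝ), (0 : ℝ))).prod b)
    (p := b'.cast hmid rfl) fun _ => rfl, ← S.hol_trans]
  apply S.hol_ext
  intro t
  have harg : ((N.meridian t : N.exterior) : F × ℝ) =
      (N.collar (0, -Real.sin (2 * Real.pi * t)),
        1 / 2 + N.height * Real.cos (2 * Real.pi * t)) := by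
    change N.map 0 _ = _
    rw [map, Complex.exp_ofReal_mul_I_re, Complex.exp_ofReal_mul_I_im]
  apply Subtype.ext
  rw [harg, Path.trans_apply]
  have hpi := Real.pi_pos
  split_ifs with h
  · change _ = (N.collar (0, N.sideCoord (-1) (1 / 2 + N.height * Real.cos (Real.pi * (2 * t))) 0),
      1 / 2 + N.height * Real.cos (Real.pi * (2 * t)))
    rw [sideCoord_zero, hw, show Real.pi * (2 * (t : ℝ)) = 2 * Real.pi * t by ring,
      abs_of_nonneg (Real.sin_nonneg_of_nonneg_of_le_pi (by have := t.2.1; positivity)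
        (by nlinarith))]
    simp
  · change _ = (N.collar (0, N.sideCoord 1
        (1 / 2 + N.height * Real.cos (Real.pi * (1 + (2 * t - 1)))) 0),
      1 / 2 + N.height * Real.cos (Real.pi * (1 + (2 * t - 1))))
    have h2 : Real.sin (2 * Real.pi * t) ≤ 0 := by
      have h3 : 0 ≤ Real.sin (2 * Real.pi * t - Real.pi) :=
        Real.sin_nonneg_of_nonneg_of_le_pi (by nlinarith) (by nlinarith [t.2.2])
      rw [Real.sin_sub_pi] at h3
      linarith
    rw [sideCoord_zero, hw, show Real.pi * (1 + (2 * (t : ℝ) - 1)) = 2 * Real.pi * t by ring,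
      abs_of_nonpos h2]
    simp

theorem hol_longitude (e : ℤˣ) : S.hol N.longitude =
    S.along (N.sideMap e) ((0, 0), N.high) ((1, 0), N.high) := by
  let v : Path ((0 : ℝ), (0 : ℝ)) ((1 : ℝ), (0 : ℝ)) :=
    ⟨⟨fun t => (t, 0), by fun_prop⟩, by simp, by simp⟩
  refine S.hol_eq_along (N.sideMap e) (v.prod (Path.refl N.high)) fun t => ?_
  apply Subtype.ext
  change N.map t 1 = (N.collar (t, N.sideCoord e N.high 0), 1 / 2 + N.height)
  rw [sideCoord_zero, halfWidth_high]
  simp [map]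

end

/-! ### Existence of the perturbed transport -/

section twist
variable [T2Space F] [IsManifold (𝓡 2) ∞ F]

omit [IsManifold (𝓡 2) ∞ F] in
theorem isClosed_carrier : IsClosed C.carrier := by
  have : C.carrier = C '' Set.Icc 0 1 := by
    apply Set.Subset.antisymm
    · rintro _ ⟨s, rfl⟩
      refine ⟨Int.fract s, ⟨Int.fract_nonneg s, (Int.fract_lt_one s).le⟩, ?_⟩
      have hp : Function.Periodic C 1 := C.periodic
      have := hp.sub_int_mul_eq (x := s) ⌊s⌋
      rwa [mul_one] at this
    · rintro _ ⟨s, -, rfl⟩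
      exact ⟨s, rfl⟩
  rw [this]
  exact (isCompact_Icc.image C.smooth.continuous).isClosed

/-- The open cover of the exterior given by the complement of the vertical annulus above the solid
torus, and a neighborhood of this annulus. -/
def cutCover (b : Bool) : Set N.exterior :=
  bif b then {q | ¬ (q.1.1 ∈ C.carrier ∧ 1 / 2 + N.height ≤ q.1.2)}
  else {q | q.1.1 ∈ Set.range N.collar ∧ 1 / 2 - N.height < q.1.2}

theorem isOpen_cutCover (b : Bool) : IsOpen (N.cutCover b) := by
  cases b
  · exact (N.isOpenMap_collar.isOpen_range.preimage (by fun_prop)).inter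
      (isOpen_Ioi.preimage (f := fun q : N.exterior => q.1.2) (by fun_prop))
  · exact ((isClosed_carrier.preimage (f := fun q : N.exterior => q.1.1) (by fun_prop)).inter
      (isClosed_Ici.preimage (f := fun q : N.exterior => q.1.2) (by fun_prop))).isOpen_compl

omit [T2Space F] [IsManifold (𝓡 2) ∞ F] in
theorem exists_mem_cutCover (q : N.exterior) : ∃ b, q ∈ N.cutCover b := by
  by_cases h : q ∈ N.cutCover true
  · exact ⟨true, h⟩
  · obtain ⟨⟨s, hs⟩, h2⟩ := not_not.1 h
    exact ⟨false, ⟨(s, 0), by rw [N.core]; exact hs⟩, by linarith [N.height_pos]⟩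

variable {G : Type*} [Group G] (R : Transport F G) {f : G → G}
  (hf : ∀ h g, f (h * g * h⁻¹) = h * f g * h⁻¹)
include hf

/-- The pull-back of `R` is kept off the cutting annulus and gauge transformed near it; the two
agree where both are defined, which is not true across the annulus itself. -/
theorem exists_twist : ∃ T : Transport N.exterior G,
    (∀ {a b : N.exterior} (p : Path a b), (∀ t, p t ∈ N.cutCover true) →
      T.hol p = (R.comap N.proj).hol p) ∧
    (∀ {a b : N.exterior} (p : Path a b), (∀ t, p t ∈ N.cutCover false) →
      T.hol p = N.leftGauge R f (N.proj a) * (R.comap N.proj).hol p *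
        (N.leftGauge R f (N.proj b))⁻¹) := by
  let g : Bool → N.exterior → G := fun b q => bif b then 1 else N.leftGauge R f (N.proj q)
  have key : ∀ {a b : N.exterior} (p : Path a b),
      (∀ t, p t ∈ N.cutCover true ∩ N.cutCover false) →
      N.leftGauge R f (N.proj a) * (R.comap N.proj).hol p * (N.leftGauge R f (N.proj b))⁻¹ =
        (R.comap N.proj).hol p := by
    intro a b p hp
    obtain ⟨P, hP⟩ := (hp 0).2.1
    rw [p.source] at hP
    change N.collar P = N.proj a at hP
    obtain ⟨Q, v, hv⟩ := N.exists_lift (p.map N.proj.continuous) (fun t => (hp t).2.1) P hP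
    have h1 : (R.comap N.proj).hol p = R.along N.collarMap P Q :=
      R.hol_eq_along N.collarMap v fun t => (hv t).symm
    have hQ : N.collar Q = N.proj b := by simpa using hv 1
    -- A point of the exterior over `C` is below or above the solid torus; one set of the cover
    -- excludes the first case and the other the second. The path therefore never changes sides.
    have hne : ∀ t, (v t).2 ≠ 0 := by
      intro t h0
      have e1 : N.collar ((v t).1, 0) = (p t).1.1 := by
        have := hv t
        rwa [← Prod.mk.eta (p := v t), h0] at this
      have e2 := (p t).2
      rw [← Prod.mk.eta (p := (p t).1), ← e1] at e2
      have e3 := N.height_le_of_mem_exterior e2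
      have e4 := (hp t).2.2
      refine (hp t).1 ⟨⟨(v t).1, by rw [← N.core]; exact e1⟩, ?_⟩
      rcases le_abs.1 e3 with h | h <;> linarith
    have hc : Continuous fun t => (v t).2 := by fun_prop
    rw [h1, ← hQ, ← hP]
    refine N.leftGauge_mul_along R hf ⟨fun h => ?_, fun h => ?_⟩
    · by_contra h'
      obtain ⟨t, ht⟩ := mem_range_of_exists_le_of_exists_ge hc
        ⟨1, by simpa using h'⟩ ⟨0, by simpa using h.le⟩
      exact hne t ht
    · by_contra h'
      obtain ⟨t, ht⟩ := mem_range_of_exists_le_of_exists_ge hc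
        ⟨0, by simpa using h'⟩ ⟨1, by simpa using h.le⟩
      exact hne t ht
  obtain ⟨T, hT⟩ := (R.comap N.proj).exists_glue (U := N.cutCover) (g := g) (by
    intro i j a b p hp
    cases i <;> cases j
    · rfl
    · change _ * _ * _ = 1 * _ * 1⁻¹
      rw [one_mul, inv_one, mul_one]
      exact key p fun t => (hp t).symm
    · change 1 * _ * 1⁻¹ = _ * _ * _
      rw [one_mul, inv_one, mul_one]
      exact (key p hp).symm
    · rfl) N.isOpen_cutCover N.exists_mem_cutCover
  refine ⟨T, fun {a b} p hp => ?_, fun {a b} p hp => hT false p hp⟩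
  have := hT true p hp
  change _ = 1 * _ * 1⁻¹ at this
  rw [this]; group

theorem exists_perturbed_transport : ∃ T : Transport N.exterior G,
    (∀ {a b : F} (p : Path a b), T.hol (p.map N.inclBottom.continuous) = R.hol p) ∧
    T.hol N.vertical = 1 ∧
    T.hol N.meridian = f (T.hol N.longitude) ∧
    (∀ {a b : F} (p : Path a b), (∀ t, p t ∉ C.carrier) →
      T.hol (p.map N.inclTop.continuous) = R.hol p) ∧
    (∀ {a b : F} (p : Path a b), (∀ t, p t ∈ Set.range N.collar) →
      T.hol (p.map N.inclTop.continuous) =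
        N.leftGauge R f a * R.hol p * (N.leftGauge R f b)⁻¹) := by
  obtain ⟨T, hT, hT'⟩ := N.exists_twist R hf
  have hh := N.height_pos
  refine ⟨T, fun p => ?_, ?_, ?_, fun p hp => ?_, fun p hp => ?_⟩
  · exact hT _ fun t h => by
      have : 1 / 2 + N.height ≤ 0 := h.2
      linarith
  · rw [hT _ fun t h => ?_]
    · exact R.hol_eq_one_of_const fun _ => rfl
    · obtain ⟨s, hs⟩ := h.1
      exact N.base_notMem s 0 (by simp) ((N.core s).trans hs)
  · have pr : ∀ e t, N.proj (N.sideMap e ((0, 0), t)) = N.collar (0, (e : ℤ) * N.halfWidth t) :=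
      fun e t => by rw [← sideCoord_zero]; rfl
    have hR : ∀ e t t', (R.comap N.proj).along (N.sideMap e) ((0, 0), t) ((0, 0), t') =
        R.along N.collarMap (0, (e : ℤ) * N.halfWidth t) (0, (e : ℤ) * N.halfWidth t') := by
      intro e t t'
      rw [← sideCoord_zero, ← sideCoord_zero]
      have hc := N.continuous_halfWidth
      exact R.along_comp N.collarMap ⟨fun p : (ℝ × ℝ) × I => (p.1.1, N.sideCoord e p.2 p.1.2),
        by unfold sideCoord; fun_prop⟩ ((0, 0), t) ((0, 0), t')
    -- The meridian is split at the middle level. Below it the transport is untwisted; above it the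
    -- gauge enters, at the middle level only, since it is trivial over `C`.
    have h1 : ∀ e, T.along (N.sideMap e) ((0, 0), N.low) ((0, 0), mid) =
        R.along N.collarMap (0, 0) (0, (e : ℤ)) := by
      intro e
      let w := (Path.refl ((0 : ℝ), (0 : ℝ))).prod (segPath N.low mid)
      rw [← T.hol_eq_along (N.sideMap e) w (p := w.map (N.sideMap e).continuous) fun _ => rfl, hT,
        (R.comap N.proj).hol_eq_along (N.sideMap e) w fun _ => rfl, hR, halfWidth_low,
        show ((mid : I) : ℝ) = 1 / 2 from rfl, halfWidth_half, mul_zero, mul_one]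
      intro t h
      have h2 : ((segPath N.low mid t : I) : ℝ) ≤ 1 / 2 := (segPath_mem_Icc N.low_le_mid t).2
      have h3 : 1 / 2 + N.height ≤ (segPath N.low mid t : I) := h.2
      linarith
    have h2 : ∀ e : ℤˣ, T.along (N.sideMap e) ((0, 0), mid) ((0, 0), N.high) =
        N.leftGauge R f (N.collar (0, (e : ℤ))) * R.along N.collarMap (0, (e : ℤ)) (0, 0) := by
      intro e
      let w := (Path.refl ((0 : ℝ), (0 : ℝ))).prod (segPath mid N.high)
      rw [← T.hol_eq_along (N.sideMap e) w (p := w.map (N.sideMap e).continuous) fun _ => rfl, hT',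
        (R.comap N.proj).hol_eq_along (N.sideMap e) w fun _ => rfl, hR, pr, pr, halfWidth_high,
        show ((mid : I) : ℝ) = 1 / 2 from rfl, halfWidth_half, mul_zero, mul_one,
        N.leftGauge_of_nonpos R f (p := (0, 0)) le_rfl, inv_one, mul_one]
      intro t
      refine ⟨⟨_, rfl⟩, ?_⟩
      have h3 : 1 / 2 ≤ ((segPath mid N.high t : I) : ℝ) := (segPath_mem_Icc N.mid_le_high t).1
      change 1 / 2 - N.height < (segPath mid N.high t : I)
      linarith
    have h3 : ∀ e : ℤˣ, T.along (N.sideMap e) ((0, 0), N.low) ((0, 0), N.high) =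
        R.along N.collarMap (0, 0) (0, (e : ℤ)) *
        N.leftGauge R f (N.collar (0, (e : ℤ))) * R.along N.collarMap (0, (e : ℤ)) (0, 0) := by
      intro e
      rw [← T.along_mul _ _ ((0, 0), mid), h1, h2, mul_assoc]
    -- The longitude projects onto `C`, where the gauge is `1` by convention, so the twist does not
    -- affect it.
    have h4 : T.hol N.longitude = N.circleHol R (0, 0) := by
      have hl : ∀ t, N.longitude t ∈ N.cutCover false := fun t =>
        ⟨⟨_, rfl⟩, by
          change 1 / 2 - N.height < 1 / 2 + N.height * (1 : ℂ).re
          rw [Complex.one_re]; linarith⟩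
      have hc : N.proj N.corner = N.collar (0, 0) := by
        change N.collar (0, -(1 : ℂ).im) = _
        simp
      rw [hT' _ hl, hc, N.leftGauge_of_nonpos R f (p := (0, 0)) le_rfl, circleHol, zero_add]
      let v : Path ((0 : ℝ), (0 : ℝ)) ((1 : ℝ), (0 : ℝ)) :=
        ⟨⟨fun t => (t, 0), by fun_prop⟩, by simp, by simp⟩
      have hv : (R.comap N.proj).hol N.longitude = R.along N.collarMap (0, 0) (1, 0) :=
        R.hol_eq_along N.collarMap v fun t => by
          change N.collar (t, -(1 : ℂ).im) = N.collar (t, 0)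
          simp
      rw [hv]; group
    have h5 := N.leftGauge_of_nonpos R f (p := (0, -1)) (by norm_num)
    have h6 := N.leftGauge_of_pos R f (p := (0, 1)) (by norm_num)
    rw [hol_meridian, ← T.along_inv, h3, h3, h4, N.map_circleHol_eq_conj R hf (0, 0) (0, 1)]
    simp only [Units.val_neg, Units.val_one, Int.cast_neg, Int.cast_one, h5, h6, R.along_inv,
      mul_one, R.along_mul, R.along_self, inv_one, one_mul]
  · exact hT _ fun t h => hp t h.1
  · exact hT' _ fun t => ⟨hp t, by
      change 1 / 2 - N.height < 1
      linarith⟩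

end twist

end PertTube
end CylinderPert

namespace CylinderPert
namespace PertTube

/-! ### Uniqueness of perturbed transports -/

open unitInterval

variable {F : Type*} [TopologicalSpace F] [ChartedSpace (EuclideanSpace ℝ (Fin 2)) F]
  {C : EmbeddedCircle F} {x : F} (N : PertTube C x) {G : Type*} [Group G]
  (S : Transport N.exterior G)

/-- The transport along the bottom of the exterior, in collar coordinates. -/
def bottomAlong (p q : ℝ × ℝ) : G := (S.comap N.inclBottom).along N.collarMap p q

/-- The transport along the top of the exterior, in collar coordinates. -/
def topAlong (p q : ℝ × ℝ) : G := (S.comap N.inclTop).along N.collarMap p q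

theorem sideMap_along_eq_bottomAlong (e : ℤˣ) {p q : ℝ × ℝ} (hp : 0 ≤ (e : ℤ) * p.2)
    (hq : 0 ≤ (e : ℤ) * q.2) :
    S.along (N.sideMap e) (p, 0) (q, 0) = N.bottomAlong S p q := by
  have hc := N.continuous_halfWidth
  let k : C(ℝ × ℝ, ℝ × ℝ) := ⟨fun p => (p.1, N.sideCoord e 0 p.2), by unfold sideCoord; fun_prop⟩
  have hk : ∀ {p : ℝ × ℝ}, 0 ≤ (e : ℤ) * p.2 → k p = p := fun {p} h =>
    Prod.ext rfl (N.sideCoord_of_le (by rwa [halfWidth_zero]))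
  have e1 : (N.sideMap e).comp ((ContinuousMap.id _).prodMk (.const _ 0)) =
      (N.inclBottom.comp N.collarMap).comp k := by
    ext p <;> rfl
  have e2 := S.along_comp (N.sideMap e) ((ContinuousMap.id _).prodMk (.const _ 0)) p q
  rw [e1, S.along_comp, hk hp, hk hq] at e2
  exact e2.symm

theorem sideMap_along_eq_topAlong (e : ℤˣ) {p q : ℝ × ℝ} (hp : 0 ≤ (e : ℤ) * p.2)
    (hq : 0 ≤ (e : ℤ) * q.2) :
    S.along (N.sideMap e) (p, 1) (q, 1) = N.topAlong S p q := by
  have hc := N.continuous_halfWidth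
  let k : C(ℝ × ℝ, ℝ × ℝ) := ⟨fun p => (p.1, N.sideCoord e 1 p.2), by unfold sideCoord; fun_prop⟩
  have hk : ∀ {p : ℝ × ℝ}, 0 ≤ (e : ℤ) * p.2 → k p = p := fun {p} h =>
    Prod.ext rfl (N.sideCoord_of_le (by rwa [halfWidth_one]))
  have e1 : (N.sideMap e).comp ((ContinuousMap.id _).prodMk (.const _ 1)) =
      (N.inclTop.comp N.collarMap).comp k := by
    ext p <;> rfl
  have e2 := S.along_comp (N.sideMap e) ((ContinuousMap.id _).prodMk (.const _ 1)) p q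
  rw [e1, S.along_comp, hk hp, hk hq] at e2
  exact e2.symm

/-- The transport from the bottom to the top over the collar point `p`, passing the solid torus on
the side `e`. -/
def sideHol (e : ℤˣ) (p : ℝ × ℝ) : G :=
  N.bottomAlong S p (p.1, 0) * S.along (N.sideMap e) ((p.1, 0), 0) ((p.1, 0), 1) *
    N.topAlong S (p.1, 0) p

theorem bottomAlong_mul (p q r : ℝ × ℝ) :
    N.bottomAlong S p q * N.bottomAlong S q r = N.bottomAlong S p r :=
  (S.comap N.inclBottom).along_mul _ _ _ _

theorem topAlong_mul (p q r : ℝ × ℝ) :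
    N.topAlong S p q * N.topAlong S q r = N.topAlong S p r :=
  (S.comap N.inclTop).along_mul _ _ _ _

/-- Over `C`, the vertical strip on side `e` unwraps to a simply connected region, so vertical
transport intertwines bottom and top. The detour through `C` in `sideHol` extends this to all collar
points, including those on the other side. -/
theorem sideHol_mul_topAlong (e : ℤˣ) (p q : ℝ × ℝ) :
    N.sideHol S e p * N.topAlong S p q = N.bottomAlong S p q * N.sideHol S e q := by
  have h0 : ∀ s : ℝ, 0 ≤ (e : ℤ) * ((s, 0) : ℝ × ℝ).2 := fun s => by simp
  have h1 : S.along (N.sideMap e) ((p.1, 0), 0) ((p.1, 0), 1) * N.topAlong S (p.1, 0) (q.1, 0) =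
      N.bottomAlong S (p.1, 0) (q.1, 0) *
        S.along (N.sideMap e) ((q.1, 0), 0) ((q.1, 0), 1) := by
    rw [← N.sideMap_along_eq_topAlong S e (h0 _) (h0 _),
      ← N.sideMap_along_eq_bottomAlong S e (h0 _) (h0 _), S.along_mul, S.along_mul]
  rw [sideHol, sideHol, mul_assoc, N.topAlong_mul, ← N.topAlong_mul S (p.1, 0) (q.1, 0) q,
    ← mul_assoc, mul_assoc (N.bottomAlong S p _), h1, ← mul_assoc, N.bottomAlong_mul,
    ← mul_assoc, ← mul_assoc, N.bottomAlong_mul]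

theorem sideHol_eq (e : ℤˣ) {p : ℝ × ℝ} (hp : 0 ≤ (e : ℤ) * p.2) :
    N.sideHol S e p = S.along (N.sideMap e) (p, 0) (p, 1) := by
  have h0 : 0 ≤ (e : ℤ) * ((p.1, 0) : ℝ × ℝ).2 := by simp
  rw [sideHol, ← N.sideMap_along_eq_topAlong S e h0 hp,
    ← N.sideMap_along_eq_bottomAlong S e hp h0, S.along_mul, S.along_mul]

theorem sideHol_add_int (e : ℤˣ) (p : ℝ × ℝ) (n : ℤ) :
    N.sideHol S e (p.1 + n, p.2) = N.sideHol S e p := by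
  rw [sideHol, sideHol, bottomAlong, bottomAlong, topAlong, topAlong,
    ← N.along_collarMap_add_int _ p _ n, ← N.along_collarMap_add_int _ _ p n]
  congr 2
  exact S.along_translate (N.sideMap e) ⟨fun p => ((p.1.1 + n, p.1.2), p.2), by fun_prop⟩
    (fun p => Subtype.ext (Prod.ext (N.collar_add_int _ _ n) rfl)) ((p.1, 0), 0) ((p.1, 0), 1)

/-- The vertical path over a point outside of the annulus. -/
def verticalAt (y : F) (hy : ∀ s u, |u| ≤ 1 → N.collar (s, u) ≠ y) :
    Path (N.inclBottom y) (N.inclTop y) where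
  toFun t := ⟨(y, t), N.mem_exterior_of_forall_ne t.2 hy⟩
  continuous_toFun := by fun_prop
  source' := by ext <;> rfl
  target' := by ext <;> rfl

theorem sideHol_eq_hol_verticalAt (e : ℤˣ) {p : ℝ × ℝ} (hp : 1 ≤ (e : ℤ) * p.2)
    (hy : ∀ s u, |u| ≤ 1 → N.collar (s, u) ≠ N.collar p) :
    N.sideHol S e p = S.hol (N.verticalAt (N.collar p) hy) := by
  rw [N.sideHol_eq S e (by linarith),
    ← S.hol_eq_along (N.sideMap e) ((Path.refl p).prod (segPath 0 1)) fun t => ?_]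
  apply Subtype.ext
  change (N.collar p, (t : ℝ)) =
    (N.collar (p.1, N.sideCoord e (segPath 0 1 t : I) p.2), ((segPath 0 1 t : I) : ℝ))
  rw [segPath_zero_one, N.sideCoord_of_le ((N.halfWidth_le_one _).trans hp)]

theorem hol_verticalAt_mul {a b : F} (w : Path a b)
    (hw : ∀ t s u, |u| ≤ 1 → N.collar (s, u) ≠ w t)
    (ha : ∀ s u, |u| ≤ 1 → N.collar (s, u) ≠ a) (hb : ∀ s u, |u| ≤ 1 → N.collar (s, u) ≠ b) :
    S.hol (N.verticalAt a ha) * S.hol (w.map N.inclTop.continuous) =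
      S.hol (w.map N.inclBottom.continuous) * S.hol (N.verticalAt b hb) := by
  let k : C(I × I, N.exterior) :=
    ⟨fun q => ⟨(w q.1, q.2), N.mem_exterior_of_forall_ne q.2.2 (hw q.1)⟩, by fun_prop⟩
  rw [S.hol_eq_along k ((Path.refl (0 : I)).prod (segPath 0 1)) (p := N.verticalAt a ha),
    S.hol_eq_along k ((segPath 0 1).prod (Path.refl (1 : I))) (p := w.map N.inclTop.continuous),
    S.hol_eq_along k ((segPath 0 1).prod (Path.refl (0 : I))) (p := w.map N.inclBottom.continuous),
    S.hol_eq_along k ((Path.refl (1 : I)).prod (segPath 0 1)) (p := N.verticalAt b hb),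
    S.along_mul, S.along_mul]
  all_goals
    intro t
    apply Subtype.ext
    simp only [k, ContinuousMap.coe_mk, Path.prod_coe, Path.refl_apply, segPath_zero_one,
      Path.source, Path.target]
    rfl

variable {f : G → G} (hf : ∀ h g, f (h * g * h⁻¹) = h * f g * h⁻¹)

section
include hf

/-- Passing the solid torus on the left and coming back on the right encircles the meridian. The
perturbation condition turns it into `f` of the longitude, and the longitude can be pushed down to
the bottom. -/
theorem sideHol_one_eq (hS : S.hol N.meridian = f (S.hol N.longitude)) (p : ℝ × ℝ) :
    N.sideHol S 1 p =
      f (N.circleHol (S.comap N.inclBottom) p) * N.sideHol S (-1) p := by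
  have h0 : ∀ (e : ℤˣ) (s : ℝ), 0 ≤ (e : ℤ) * ((s, 0) : ℝ × ℝ).2 := fun e s => by simp
  have hlo : S.along (N.sideMap 1) ((0, 0), 0) ((0, 0), N.low) =
      S.along (N.sideMap (-1)) ((0, 0), 0) ((0, 0), N.low) := by
    let w := (Path.refl ((0 : ℝ), (0 : ℝ))).prod (segPath 0 N.low)
    rw [← S.hol_eq_along (N.sideMap 1) w (p := w.map (N.sideMap 1).continuous) fun _ => rfl]
    refine S.hol_eq_along (N.sideMap (-1)) w fun t => ?_
    apply Subtype.ext
    change (N.collar (0, N.sideCoord _ _ 0), _) = (N.collar (0, N.sideCoord _ _ 0), _)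
    have h1 : (((w t).2 : I) : ℝ) ≤ 1 / 2 - N.height :=
      (segPath_mem_Icc (s := 0) (t := N.low) nonneg' t).2
    rw [sideCoord_zero, sideCoord_zero, N.halfWidth_eq_zero (le_abs.2 (Or.inr (by linarith)))]
    simp
  have hhi : S.along (N.sideMap 1) ((0, 0), N.high) ((0, 0), 1) =
      S.along (N.sideMap (-1)) ((0, 0), N.high) ((0, 0), 1) := by
    let w := (Path.refl ((0 : ℝ), (0 : ℝ))).prod (segPath N.high 1)
    rw [← S.hol_eq_along (N.sideMap 1) w (p := w.map (N.sideMap 1).continuous) fun _ => rfl]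
    refine S.hol_eq_along (N.sideMap (-1)) w fun t => ?_
    apply Subtype.ext
    change (N.collar (0, N.sideCoord _ _ 0), _) = (N.collar (0, N.sideCoord _ _ 0), _)
    have h1 : 1 / 2 + N.height ≤ (((w t).2 : I) : ℝ) :=
      (segPath_mem_Icc (s := N.high) (t := 1) le_one' t).1
    rw [sideCoord_zero, sideCoord_zero, N.halfWidth_eq_zero (le_abs.2 (Or.inl (by linarith)))]
    simp
  -- Pushing down sweeps out a strip whose two vertical edges are translates by one period, hence
  -- have equal transport.
  have hcirc : S.along (N.sideMap 1) ((0, 0), 0) ((0, 0), N.high) * S.hol N.longitude *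
      (S.along (N.sideMap 1) ((0, 0), 0) ((0, 0), N.high))⁻¹ =
      N.circleHol (S.comap N.inclBottom) (0, 0) := by
    have h1 := S.along_translate (N.sideMap 1)
      ⟨fun p => ((p.1.1 + 1, p.1.2), p.2), by fun_prop⟩
      (fun p => Subtype.ext (Prod.ext (N.periodic _ _) rfl)) ((0, 0), 0) ((0, 0), N.high)
    simp only [ContinuousMap.coe_mk, zero_add] at h1
    rw [N.hol_longitude S 1, S.along_mul, ← h1, S.along_inv, S.along_mul,
      N.sideMap_along_eq_bottomAlong S 1 (h0 _ _) (h0 _ _), circleHol, zero_add]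
    rfl
  have hzero : N.sideHol S 1 (0, 0) * (N.sideHol S (-1) (0, 0))⁻¹ =
      f (N.circleHol (S.comap N.inclBottom) (0, 0)) := by
    rw [← hcirc, hf, ← hS, hol_meridian, N.sideHol_eq S _ (h0 _ _), N.sideHol_eq S _ (h0 _ _),
      ← S.along_mul (N.sideMap 1) _ ((0, 0), N.high) ((0, 0), 1),
      ← S.along_mul (N.sideMap (-1)) _ ((0, 0), N.high) ((0, 0), 1),
      ← S.along_mul (N.sideMap (-1)) _ ((0, 0), N.low) ((0, 0), N.high),
      ← S.along_mul (N.sideMap 1) _ ((0, 0), N.low) ((0, 0), N.high), hhi, hlo,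
      ← S.along_inv (N.sideMap (-1)) ((0, 0), N.low) ((0, 0), N.high)]
    group
  -- The identity over the single point `(0, 0)` spreads to every `p`, as all three factors are
  -- transported compatibly.
  have h1 := N.sideHol_mul_topAlong S 1 p (0, 0)
  have h2 := N.sideHol_mul_topAlong S (-1) p (0, 0)
  have h3 := N.map_circleHol_eq_conj (S.comap N.inclBottom) hf p (0, 0)
  rw [← eq_mul_inv_iff_mul_eq] at h1 h2
  change _ = N.bottomAlong S p (0, 0) * _ * (N.bottomAlong S p (0, 0))⁻¹ at h3
  rw [h1, h2, h3, ← hzero]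
  group

end

section

variable (S' : Transport N.exterior G) (k : F → G)

open Classical in
/-- A gauge transformation `k` between the restrictions of two transports to the bottom, carried to
the top. -/
def topGauge (y : F) : G :=
  if h : y ∈ Set.range N.collar then
    (N.sideHol S 1 h.choose)⁻¹ * k y * N.sideHol S' 1 h.choose
  else if h : ∀ s u, |u| ≤ 1 → N.collar (s, u) ≠ y then
    (S.hol (N.verticalAt y h))⁻¹ * k y * S'.hol (N.verticalAt y h)
  else 1

theorem topGauge_collar (p : ℝ × ℝ) : N.topGauge S S' k (N.collar p) =
    (N.sideHol S 1 p)⁻¹ * k (N.collar p) * N.sideHol S' 1 p := by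
  have h : N.collar p ∈ Set.range N.collar := ⟨p, rfl⟩
  rw [topGauge, dif_pos h]
  obtain ⟨h1, n, h2⟩ := N.injective _ _ _ _ (show N.collar (p.1, p.2) = N.collar
    (h.choose.1, h.choose.2) from h.choose_spec.symm)
  have h3 : h.choose = (p.1 + n, p.2) := Prod.ext h2 h1
  rw [h3, N.sideHol_add_int, N.sideHol_add_int]

variable {S S' k}

include hf in
-- The collar reaches beyond the closed annulus, so both clauses of `topGauge` apply there. On the
-- left they agree at once. On the right the extra factors of `sideHol_one_eq` for `S` and `S'` are
-- conjugate by `k`, and cancel.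
theorem topGauge_of_forall_ne (hS : S.hol N.meridian = f (S.hol N.longitude))
    (hS' : S'.hol N.meridian = f (S'.hol N.longitude))
    (hk : ∀ {a b : F} (w : Path a b), S'.hol (w.map N.inclBottom.continuous) =
      (k a)⁻¹ * S.hol (w.map N.inclBottom.continuous) * k b)
    {y : F} (h : ∀ s u, |u| ≤ 1 → N.collar (s, u) ≠ y) :
    N.topGauge S S' k y = (S.hol (N.verticalAt y h))⁻¹ * k y * S'.hol (N.verticalAt y h) := by
  by_cases hy : y ∈ Set.range N.collar
  · obtain ⟨p, rfl⟩ := hy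
    rw [topGauge_collar]
    have hp : 1 < |p.2| := not_le.1 fun hp => h p.1 p.2 hp rfl
    rcases lt_abs.1 hp with hp | hp
    · rw [N.sideHol_eq_hol_verticalAt S 1 (by simpa using hp.le) h,
        N.sideHol_eq_hol_verticalAt S' 1 (by simpa using hp.le) h]
    · rw [N.sideHol_one_eq S hf hS, N.sideHol_one_eq S' hf hS',
        N.sideHol_eq_hol_verticalAt S (-1) (by simpa using hp.le) h,
        N.sideHol_eq_hol_verticalAt S' (-1) (by simpa using hp.le) h]
      have hc : N.circleHol (S'.comap N.inclBottom) p =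
          (k (N.collar p))⁻¹ * N.circleHol (S.comap N.inclBottom) p * (k (N.collar p))⁻¹⁻¹ := by
        let v : Path p (p.1 + 1, p.2) :=
          ⟨⟨fun t => (p.1 + t, p.2), by fun_prop⟩, by simp, by simp⟩
        have h1 := hk ((v.map N.smooth.continuous).cast rfl (N.periodic p.1 p.2).symm)
        rw [inv_inv]
        convert h1 using 2
        · exact ((S'.comap N.inclBottom).hol_eq_along N.collarMap v
            (p := (v.map N.smooth.continuous).cast rfl (N.periodic p.1 p.2).symm)
            fun _ => rfl).symm
        · congr 1
          exact ((S.comap N.inclBottom).hol_eq_along N.collarMap v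
            (p := (v.map N.smooth.continuous).cast rfl (N.periodic p.1 p.2).symm)
            fun _ => rfl).symm
      rw [hc, hf]
      group
  · rw [topGauge, dif_neg hy, dif_pos h]

variable [T2Space F] [IsManifold (𝓡 2) ∞ F]

omit [IsManifold (𝓡 2) ∞ F] in
theorem isOpen_forall_ne : IsOpen {y | ∀ s u, |u| ≤ 1 → N.collar (s, u) ≠ y} := by
  have : {y | ∀ s u, |u| ≤ 1 → N.collar (s, u) ≠ y} =
      (N.collar '' (Set.Icc 0 1 ×ˢ Set.Icc (-1) 1))ᶜ := by
    ext y
    rw [Set.mem_compl_iff, Set.mem_image, not_exists]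
    constructor
    · rintro h ⟨s, u⟩ ⟨hu, he⟩
      exact h s u (abs_le.2 hu.2) he
    · intro h s u hu he
      refine h (Int.fract s, u) ⟨⟨⟨Int.fract_nonneg s, (Int.fract_lt_one s).le⟩, abs_le.1 hu⟩, ?_⟩
      rw [← he, ← N.collar_add_int (Int.fract s) u ⌊s⌋, Int.fract_add_floor]
  rw [this]
  exact ((isCompact_Icc.prod isCompact_Icc).image N.smooth.continuous).isClosed.isOpen_compl

include hf in
/-- A perturbed transport on the exterior is determined by its restriction to the bottom. -/
theorem hol_top_eq (hS : S.hol N.meridian = f (S.hol N.longitude))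
    (hS' : S'.hol N.meridian = f (S'.hol N.longitude))
    (hk : ∀ {a b : F} (w : Path a b), S'.hol (w.map N.inclBottom.continuous) =
      (k a)⁻¹ * S.hol (w.map N.inclBottom.continuous) * k b) (w : Path x x) :
    S'.hol (connect N.vertical (w.map N.inclTop.continuous)) =
      (k x)⁻¹ * S.hol (connect N.vertical (w.map N.inclTop.continuous)) * k x := by
  have hx : ∀ s u, |u| ≤ 1 → N.collar (s, u) ≠ x := N.base_notMem
  -- Over the collar the gauge relation follows by lifting to the plane and using `sideHol`; off the
  -- closed annulus it follows from vertical transport.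
  have key := (S.comap N.inclTop).hol_eq_of_locally
    (U := fun b : Bool => bif b then {y | ∀ s u, |u| ≤ 1 → N.collar (s, u) ≠ y}
      else Set.range N.collar) (by
        rintro (_ | _)
        · exact N.isOpenMap_collar.isOpen_range
        · exact N.isOpen_forall_ne)
    (S'.comap N.inclTop) (N.topGauge S S' k) (by
      rintro (_ | _) a b p hp
      · obtain ⟨P, rfl⟩ : a ∈ Set.range N.collar := by simpa using hp 0
        obtain ⟨Q, v, hv⟩ := N.exists_lift p hp P rfl
        obtain rfl : N.collar Q = b := by simpa using hv 1
        have e1 : (S.comap N.inclTop).hol p = N.topAlong S P Q :=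
          (S.comap N.inclTop).hol_eq_along N.collarMap v fun t => (hv t).symm
        have e2 : (S'.comap N.inclTop).hol p = N.topAlong S' P Q :=
          (S'.comap N.inclTop).hol_eq_along N.collarMap v fun t => (hv t).symm
        have e3 : (S.comap N.inclBottom).hol p = N.bottomAlong S P Q :=
          (S.comap N.inclBottom).hol_eq_along N.collarMap v fun t => (hv t).symm
        have e4 : (S'.comap N.inclBottom).hol p = N.bottomAlong S' P Q :=
          (S'.comap N.inclBottom).hol_eq_along N.collarMap v fun t => (hv t).symm
        have e5 : N.bottomAlong S' P Q = _ := e4.symm.trans (hk p)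
        change _ = _ * (S.comap N.inclBottom).hol p * _ at e5
        rw [e3] at e5
        have e6 := N.sideHol_mul_topAlong S 1 P Q
        have e7 := N.sideHol_mul_topAlong S' 1 P Q
        rw [← eq_inv_mul_iff_mul_eq] at e6 e7
        rw [e1, e2, topGauge_collar, topGauge_collar, e7, e6, e5]
        group
      · have ha : ∀ s u, |u| ≤ 1 → N.collar (s, u) ≠ a := by simpa using hp 0
        have hb : ∀ s u, |u| ≤ 1 → N.collar (s, u) ≠ b := by simpa using hp 1
        have e1 := N.hol_verticalAt_mul S p hp ha hb
        have e2 := N.hol_verticalAt_mul S' p hp ha hb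
        rw [← eq_inv_mul_iff_mul_eq] at e1 e2
        rw [N.topGauge_of_forall_ne hf hS hS' hk ha, N.topGauge_of_forall_ne hf hS hS' hk hb]
        change S'.hol (p.map N.inclTop.continuous) = _ * S.hol (p.map N.inclTop.continuous) * _
        rw [e1, e2, hk]
        group) w (by
      intro t
      by_cases h : w t ∈ Set.range N.collar
      · exact ⟨false, h⟩
      · exact ⟨true, fun s u _ he => h ⟨(s, u), he⟩⟩)
  have hv : N.vertical = N.verticalAt x hx := rfl
  change S'.hol (w.map N.inclTop.continuous) = _ * S.hol (w.map N.inclTop.continuous) * _ at key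
  rw [S.hol_connect, S'.hol_connect, key, N.topGauge_of_forall_ne hf hS hS' hk hx, hv]
  group

end

end PertTube
end CylinderPert

namespace CylinderPert
namespace PertTube

/-! ### Transport along curves that cross the annulus -/

section crossing
open unitInterval Filter Topology

variable {F : Type*} [TopologicalSpace F] [ChartedSpace (EuclideanSpace ℝ (Fin 2)) F]
  {C : EmbeddedCircle F} {x : F} (N : PertTube C x) {G : Type*} [Group G] (R : Transport F G)
  [IsManifold (𝓡 2) ∞ F] {f : G → G} (hf : ∀ h g, f (h * g * h⁻¹) = h * f g * h⁻¹)

include hf in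
theorem map_circleHol_eq_conj_hol {a b : F} (w : Path a b) (hw : ∀ t, w t ∈ Set.range N.collar)
    {p q : ℝ × ℝ} (hp : N.collar p = a) (hq : N.collar q = b) :
    f (N.circleHol R p) = R.hol w * f (N.circleHol R q) * (R.hol w)⁻¹ := by
  obtain ⟨q', v, hv⟩ := N.exists_lift w hw p hp
  have hq' : N.collar q' = b := by simpa using hv 1
  obtain ⟨h1, n, h2⟩ := N.injective _ _ _ _ (show N.collar (q.1, q.2) = N.collar (q'.1, q'.2)
    from hq.trans hq'.symm)
  have h3 : q' = (q.1 + n, q.2) := Prod.ext h2 h1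
  have h4 : N.circleHol R q' = N.circleHol R q := by rw [h3, N.circleHol_add_int]
  rw [R.hol_eq_along N.collarMap v fun t => (hv t).symm, N.map_circleHol_eq_conj R hf p q', h4]

/-- Transversality gives collar coordinates of opposite signs just before and just after the
crossing, with the stretch between inside the collar. -/
theorem exists_crossing_interval {a b : F} {p : Path a b} {t : I} {s : ℝ} {ε : ℤˣ}
    (h : MeetsOnce p C t s ε) :
    ∃ (t₁ t₂ : I) (P₁ P₂ : ℝ × ℝ), t₁ < t ∧ t < t₂ ∧ N.collar P₁ = p t₁ ∧ N.collar P₂ = p t₂ ∧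
      0 < (ε : ℤ) * P₁.2 ∧ (ε : ℤ) * P₂.2 < 0 ∧ ∀ r ∈ Set.Icc t₁ t₂, p r ∈ Set.range N.collar := by
  have hex : p.extend t = p t := p.extend_apply t.2
  obtain ⟨q, hq, hl, hr⟩ := N.exists_collar_coordinate p.continuous_extend (t := t) (s := s)
    (hex.trans h.meets) h.sign
  have hne : ∀ τ, N.collar (q τ) = p.extend τ → (q τ).2 ≠ 0 → p.extend τ ≠ p t := by
    intro τ h1 h2 h3
    refine h2 (N.injective s 0 (q τ).1 (q τ).2 ?_).1
    rw [N.core, Prod.mk.eta, h1, h3, h.meets]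
  have hl' := hl.and (hq.filter_mono nhdsWithin_le_nhds)
  have hr' := hr.and (hq.filter_mono nhdsWithin_le_nhds)
  -- The extended path is constant beyond its ends, while the collar coordinate is nonzero just
  -- before and after `t`; so `t` is an interior parameter.
  have h0 : (0 : ℝ) < t := by
    by_contra h0
    obtain ⟨τ, ⟨h1, h2⟩, h3⟩ := (hl'.and self_mem_nhdsWithin).exists
    have h3 : τ < t := h3
    refine hne τ h2 (fun h => by rw [h] at h1; simp at h1) ?_
    rw [p.extend_of_le_zero (h3.le.trans (not_lt.1 h0)), ← hex,
      p.extend_of_le_zero (not_lt.1 h0)]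
  have h1 : (t : ℝ) < 1 := by
    by_contra h1
    obtain ⟨τ, ⟨h2, h3⟩, h4⟩ := (hr'.and self_mem_nhdsWithin).exists
    have h4 : t < τ := h4
    refine hne τ h3 (fun h => by rw [h] at h2; simp at h2) ?_
    rw [p.extend_of_one_le ((not_lt.1 h1).trans h4.le), ← hex, p.extend_of_one_le (not_lt.1 h1)]
  obtain ⟨l, u, ⟨hlt, htu⟩, hlu⟩ := mem_nhds_iff_exists_Ioo_subset.1 hq
  obtain ⟨τ₁, ⟨⟨e1, e2⟩, e3⟩⟩ := (hl'.and (Ioo_mem_nhdsLT (max_lt hlt h0))).exists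
  obtain ⟨τ₂, ⟨⟨e4, e5⟩, e6⟩⟩ := (hr'.and (Ioo_mem_nhdsGT (lt_min htu h1))).exists
  have b1 : 0 < τ₁ := (le_max_right _ _).trans_lt e3.1
  have b2 : τ₂ < 1 := e6.2.trans_le (min_le_right _ _)
  have m1 : τ₁ ∈ I := ⟨b1.le, (e3.2.trans h1).le⟩
  have m2 : τ₂ ∈ I := ⟨(h0.trans e6.1).le, b2.le⟩
  refine ⟨⟨τ₁, m1⟩, ⟨τ₂, m2⟩, q τ₁, q τ₂, e3.2, e6.1, ?_, ?_, e1, e4, fun r hr => ?_⟩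
  · rw [e2, p.extend_apply m1]
  · rw [e5, p.extend_apply m2]
  · have i1 : τ₁ ≤ r := hr.1
    have i2 : (r : ℝ) ≤ τ₂ := hr.2
    have := hlu ⟨(le_max_left _ _).trans_lt (e3.1.trans_le i1),
      i2.trans_lt (e6.2.trans_le (min_le_left _ _))⟩
    exact ⟨q r, this.trans (p.extend_apply r.2)⟩

include hf in
/-- A transport that differs from `R` by `f` of the holonomy around `C` on the left of `C` changes
by this factor along curves that cross `C` once. -/
theorem hol_crossing (A : Transport F G)
    (h₁ : ∀ {a b : F} (p : Path a b), (∀ t, p t ∉ C.carrier) → A.hol p = R.hol p)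
    (h₂ : ∀ {a b : F} (p : Path a b), (∀ t, p t ∈ Set.range N.collar) →
      A.hol p = N.leftGauge R f a * R.hol p * (N.leftGauge R f b)⁻¹)
    {a b : F} {p : Path a b} {t : I} {s : ℝ} {ε : ℤˣ} (h : MeetsOnce p C t s ε) :
    A.hol p = R.hol (p.subpath 0 t) * f (R.hol (C.loop s)) ^ (ε : ℤ) * R.hol (p.subpath t 1) := by
  obtain ⟨t₁, t₂, P₁, P₂, ht₁, ht₂, hP₁, hP₂, hε₁, hε₂, hmem⟩ := N.exists_crossing_interval h
  have a1 : A.along (p : C(I, F)) 0 t₁ = R.along (p : C(I, F)) 0 t₁ := by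
    rw [← A.hol_subpath, ← R.hol_subpath]
    refine h₁ _ fun r hr => ?_
    exact absurd (h.unique _ hr) ((segPath_mem_Icc nonneg' r).2.trans_lt ht₁).ne
  have a3 : A.along (p : C(I, F)) t₂ 1 = R.along (p : C(I, F)) t₂ 1 := by
    rw [← A.hol_subpath, ← R.hol_subpath]
    refine h₁ _ fun r hr => ?_
    exact absurd (h.unique _ hr) (ht₂.trans_le (segPath_mem_Icc le_one' r).1).ne'
  have a2 : A.along (p : C(I, F)) t₁ t₂ = N.leftGauge R f (p t₁) *
      R.along (p : C(I, F)) t₁ t₂ * (N.leftGauge R f (p t₂))⁻¹ := by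
    rw [← A.hol_subpath, ← R.hol_subpath]
    exact h₂ _ fun r => hmem _ (segPath_mem_Icc (ht₁.trans ht₂).le r)
  have hC : N.collar (s, 0) = p t := by rw [N.core, h.meets]
  have c1 := N.map_circleHol_eq_conj_hol R hf (p.subpath t₁ t)
    (fun r => hmem _ ⟨(segPath_mem_Icc ht₁.le r).1, (segPath_mem_Icc ht₁.le r).2.trans ht₂.le⟩)
    hP₁ hC
  have c2 := N.map_circleHol_eq_conj_hol R hf (p.subpath t t₂)
    (fun r => hmem _ ⟨ht₁.le.trans (segPath_mem_Icc ht₂.le r).1, (segPath_mem_Icc ht₂.le r).2⟩)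
    hC hP₂
  rw [R.hol_subpath] at c1 c2
  rw [R.hol_subpath, R.hol_subpath, N.hol_loop, A.hol_eq_along_self,
    ← A.along_mul _ 0 t₂ 1, ← A.along_mul _ 0 t₁ t₂, a1, a2, a3, ← hP₁, ← hP₂]
  rw [← R.along_mul _ 0 t₁ t, ← R.along_mul _ t₁ t t₂, ← R.along_mul _ t t₂ 1]
  -- For `ε = 1` the stretch starts on the left, and the gauge contributes at entry; for `ε = -1` it
  -- ends on the left, and the inverse gauge contributes at exit. By flatness either factor moves to
  -- the crossing point.
  rcases Int.units_eq_one_or ε with rfl | rfl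
  · rw [N.leftGauge_of_pos R f (by simpa using hε₁),
      N.leftGauge_of_nonpos R f (by simpa using hε₂.le), c1]
    simp only [Units.val_one, zpow_one]
    group
  · rw [N.leftGauge_of_nonpos R f (p := P₁) (by simpa using hε₁.le),
      N.leftGauge_of_pos R f (p := P₂) (by simpa using hε₂), c2]
    simp only [Units.val_neg, Units.val_one, zpow_neg, zpow_one]
    group

end crossing

/-! ### The perturbed character variety -/

variable {F : Type*} [TopologicalSpace F] [ChartedSpace (EuclideanSpace ℝ (Fin 2)) F]
  {C : EmbeddedCircle F} {x : F} {N : PertTube C x} {k : ℕ} {φ : PertFun k}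

theorem bottom_loopClass (σ : N.PertRep φ) {S : Transport N.exterior SU2}
    (hS : ∀ p : Path (N.inclBottom x) (N.inclBottom x), S.hol p = σ.1 (loopClass p))
    (l : Path x x) : σ.bottom (loopClass l) = S.hol (l.map N.inclBottom.continuous) := by
  change σ.1 (pi1Map N.inclBottom x (Path.refl _) (loopClass l)) = _
  rw [pi1Map_loopClass, ← hS, S.hol_connect, S.hol_refl]
  group

theorem top_loopClass (σ : N.PertRep φ) {S : Transport N.exterior SU2}
    (hS : ∀ p : Path (N.inclBottom x) (N.inclBottom x), S.hol p = σ.1 (loopClass p))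
    (l : Path x x) : σ.top (loopClass l) =
      S.hol (connect N.vertical (l.map N.inclTop.continuous)) := by
  change σ.1 (pi1Map N.inclTop x N.vertical (loopClass l)) = _
  rw [pi1Map_loopClass, ← hS]

/-- Some connecting path must exist for the perturbation condition, which quantifies over all of
them, to have content. -/
theorem joined_corner [PathConnectedSpace F] : Joined (N.inclBottom x) N.corner := by
  have h1 : Joined (N.inclBottom x) (N.inclBottom (N.collar (0, 0))) :=
    ⟨(PathConnectedSpace.somePath x _).map N.inclBottom.continuous⟩
  have h2 : Joined (N.sideMap 1 ((0, 0), 0)) (N.sideMap 1 ((0, 0), N.high)) :=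
    ⟨(PathConnectedSpace.somePath _ _).map (N.sideMap 1).continuous⟩
  have e1 : N.sideMap 1 ((0, 0), 0) = N.inclBottom (N.collar (0, 0)) := by
    apply Subtype.ext
    change (N.collar (0, N.sideCoord 1 0 0), (0 : ℝ)) = (N.collar (0, 0), 0)
    rw [sideCoord_zero, halfWidth_zero, mul_zero]
  have e2 : N.sideMap 1 ((0, 0), N.high) = N.corner := by
    apply Subtype.ext
    change (N.collar (0, N.sideCoord 1 N.high 0), 1 / 2 + N.height) = N.map 0 1
    rw [sideCoord_zero, halfWidth_high]
    simp [map]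
  exact h1.trans (e1 ▸ e2 ▸ h2)

theorem PertRep.hol_meridian [PathConnectedSpace F] (σ : N.PertRep φ)
    {S : Transport N.exterior SU2}
    (hS : ∀ p : Path (N.inclBottom x) (N.inclBottom x), S.hol p = σ.1 (loopClass p)) :
    S.hol N.meridian = pertMap φ (S.hol N.longitude) := by
  have δ := (joined_corner (N := N)).some
  have := σ.2 δ
  rw [← hS, ← hS, S.hol_connect, S.hol_connect, pertMap_conj] at this
  simpa using this

theorem restrictTop_factorsThrough [T2Space F] [PathConnectedSpace F] [IsManifold (𝓡 2) ∞ F] :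
    (N.restrictTop φ).FactorsThrough (N.restrictBottom φ) := by
  intro c c' h
  induction c using Quotient.inductionOn with | _ σ => ?_
  induction c' using Quotient.inductionOn with | _ σ' => ?_
  obtain ⟨g, hg⟩ := Quotient.exact h
  obtain ⟨S, hS⟩ := Transport.exists_of_hom σ.1
  obtain ⟨S', hS'⟩ := Transport.exists_of_hom σ'.1
  let β : ∀ y : F, Path x y := fun y => PathConnectedSpace.somePath x y
  let B := S.comap N.inclBottom
  let B' := S'.comap N.inclBottom
  have hB : ∀ l : Path x x, B'.hol l = g * B.hol l * g⁻¹ := by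
    intro l
    have := hg (loopClass l)
    rwa [bottom_loopClass σ hS, bottom_loopClass σ' hS'] at this
  -- The conjugating element `g`, known only for loops at `x`, is spread along the paths `β` to a
  -- gauge transformation on all of `F`.
  let κ : F → SU2 := fun y => (B.hol (β y))⁻¹ * g⁻¹ * B'.hol (β y)
  have hκ : ∀ {a b : F} (w : Path a b), B'.hol w = (κ a)⁻¹ * B.hol w * κ b := by
    intro a b w
    have := hB (((β a).trans w).trans (β b).symm)
    rw [B.hol_trans, B.hol_trans, B'.hol_trans, B'.hol_trans, B.hol_symm, B'.hol_symm,
      mul_inv_eq_iff_eq_mul, ← eq_inv_mul_iff_mul_eq] at this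
    rw [this]
    simp only [κ]
    group
  refine Quotient.sound ⟨(κ x)⁻¹, fun a => ?_⟩
  obtain ⟨l, rfl⟩ := loopClass_surjective a
  rw [top_loopClass σ hS, top_loopClass σ' hS', inv_inv]
  exact N.hol_top_eq (pertMap_conj φ) (PertRep.hol_meridian σ hS)
    (PertRep.hol_meridian σ' hS') hκ l

end PertTube
end CylinderPert

end

/-! ### Proof of the proposition -/

open CylinderPert in
theorem proposition7p2 {F : Type*} [TopologicalSpace F] [T2Space F] [CompactSpace F]
    [ConnectedSpace F] [ChartedSpace (EuclideanSpace ℝ (Fin 2)) F] [IsManifold (𝓡 2) ∞ F]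
    (hF : IsOrientedAtlas F) (x : F) (C : EmbeddedCircle F) (N : PertTube C x)
    {k : ℕ} (φ : PertFun k) (ρ : Rep F x) :
    ∃ ρ' : N.PertRep φ, ρ'.bottom = ρ ∧ N.Phi φ (CharVar.mk ρ) = CharVar.mk ρ'.top ∧
      ∀ {p : F} (γ : Path x p) (E : Path p p),
        -- `C` misses `E` and `γ`
        (Disjoint C.carrier (Set.range E ∪ Set.range γ) →
          ρ'.top (loopClass (connect γ E)) = ρ (loopClass (connect γ E))) ∧
        -- `C` meets `E` once with `E · C = ε` and misses `γ`
        (∀ (t : unitInterval) (s : ℝ) (ε : ℤˣ) (h : MeetsOnce E C t s ε),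
          Disjoint C.carrier (Set.range γ) →
          ∀ (α : ℝ) (Q : ℍ[ℝ]), IsUnitImag Q →
            (ρ (loopClass (longitudeLoop C γ E h.meets)) : ℍ[ℝ]) = NormedSpace.exp (α • Q) →
            (ρ'.top (loopClass (connect γ E)) : ℍ[ℝ]) =
              NormedSpace.exp ((((ε : ℤ) : ℝ) * φ α) • Q) * ρ (loopClass (connect γ E))) ∧
        -- `C` misses `E` and meets `γ` once with `γ · C = ε`
        (∀ (t : unitInterval) (s : ℝ) (ε : ℤˣ) (h : MeetsOnce γ C t s ε),
          Disjoint C.carrier (Set.range E) →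
          ∀ (α : ℝ) (Q : ℍ[ℝ]), IsUnitImag Q →
            (ρ (loopClass (longitudeArc C γ h.meets)) : ℍ[ℝ]) = NormedSpace.exp (α • Q) →
            (ρ'.top (loopClass (connect γ E)) : ℍ[ℝ]) =
              NormedSpace.exp ((((ε : ℤ) : ℝ) * φ α) • Q) * ρ (loopClass (connect γ E)) *
                NormedSpace.exp (-(((ε : ℤ) : ℝ) * φ α) • Q)) := by
  have : LocallyPathConnectedSpace F :=
    ChartedSpace.locallyPathConnectedSpace (EuclideanSpace ℝ (Fin 2)) F
  have : PathConnectedSpace F := pathConnectedSpace_iff_connectedSpace.2 inferInstance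
  obtain ⟨R, hR⟩ := Transport.exists_of_hom ρ
  obtain ⟨T, hbot, hvert, hmer, hmiss, hcol⟩ := N.exists_perturbed_transport R (pertMap_conj φ)
  let ρ' : N.PertRep φ := ⟨T.toHom _, fun δ => by
    rw [T.toHom_loopClass, T.toHom_loopClass, T.hol_connect, T.hol_connect, hmer, pertMap_conj]⟩
  have hT : ∀ p : Path (N.inclBottom x) (N.inclBottom x), T.hol p = ρ'.1 (loopClass p) :=
    fun p => rfl
  have hbottom : ρ'.bottom = ρ := by
    ext a : 1
    obtain ⟨l, rfl⟩ := loopClass_surjective a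
    rw [PertTube.bottom_loopClass ρ' hT, hbot, hR]
  let A := T.comap N.inclTop
  have htop : ∀ l : Path x x, ρ'.top (loopClass l) = A.hol l := by
    intro l
    -- The segment over `x` has trivial holonomy, so the top representation is computed by `A`
    -- exactly, not just up to conjugacy.
    rw [PertTube.top_loopClass ρ' hT, T.hol_connect, hvert, one_mul, inv_one, mul_one]
    rfl
  have hA : ∀ {a b : F} (p : Path a b), Disjoint C.carrier (Set.range p) → A.hol p = R.hol p :=
    fun p hp => hmiss p fun t ht => Set.disjoint_left.1 hp ht ⟨t, rfl⟩
  refine ⟨ρ', hbottom, ?_, fun {p} γ E => ⟨fun h => ?_, fun t s ε h hγ α Q hQ hα => ?_,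
    fun t s ε h hE α Q hQ hα => ?_⟩⟩
  -- `Phi` is evaluated on the explicit extension `ρ'`; factoring through the bottom restriction
  -- makes the choice of extension irrelevant.
  · have h := PertTube.restrictTop_factorsThrough.extend_apply (g := N.restrictTop φ) id
      (Quotient.mk _ ρ')
    have h1 : N.restrictBottom φ (Quotient.mk _ ρ') = CharVar.mk ρ := congrArg CharVar.mk hbottom
    rw [h1] at h
    exact h
  · rw [Set.disjoint_union_right] at h
    rw [htop, ← hR, A.hol_connect, R.hol_connect, hA _ h.1, hA _ h.2]
  · rw [← hR, longitudeLoop, R.hol_connect, R.hol_trans, R.hol_cast] at hα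
    -- The factor acquired midway along `E` is moved to the front; conjugating by the path traversed
    -- so far turns the holonomy around `C` into that of the longitude.
    rw [← coe_pertMap_zpow φ _ hQ hα, htop, ← hR, A.hol_connect, R.hol_connect, hA _ hγ,
      N.hol_crossing R (pertMap_conj φ) A hmiss hcol h, pertMap_conj, ← Submonoid.coe_mul,
      R.hol_eq_along_self E, ← R.along_mul _ 0 t 1, ← R.hol_subpath, ← R.hol_subpath, conj_zpow]
    congr 1
    group
  · rw [← hR, longitudeArc, R.hol_connect, R.hol_cast] at hα
    have h1 := coe_pertMap_zpow φ _ hQ hα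
    -- The path `γ` is run through in both directions, so the factor appears on the left and its
    -- inverse on the right.
    have h2 := coe_pertMap_zpow φ _ hQ hα (-ε)
    rw [Units.val_neg, Int.cast_neg, neg_mul] at h2
    rw [← h1 ε, ← h2, htop, ← hR, A.hol_connect, R.hol_connect, hA _ hE,
      N.hol_crossing R (pertMap_conj φ) A hmiss hcol h, pertMap_conj, ← Submonoid.coe_mul,
      ← Submonoid.coe_mul, R.hol_eq_along_self γ, ← R.along_mul _ 0 t 1, ← R.hol_subpath,
      ← R.hol_subpath, conj_zpow, zpow_neg, conj_zpow]
    congr 1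
    group
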